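/- **Theorem 1.4 (Location-F).** Let $\mathbb H$ be the upper half plane, let $E_2,E_4,E_6$ be the Eisenstein series normalized to have constant term $1$ in their $q$-expansions, and put $g_2=\frac{4\pi^4}{3}E_4$, $g_3=\frac{8\pi^6}{27}E_6$, $\eta_1=\frac{\pi^2}{3}E_2$, $\eta_2(\tau)=\tau\eta_1(\tau)-2\pi i$. For $C\in\mathbb R$ let $$f_C(\tau)=(C-\tau)\,g_2(\tau)^2-18\,(C\eta_1(\tau)-\eta_2(\tau))\,g_3(\tau),\qquad \tau\in\mathbb H .$$ Let $$F_0=\{\tau\in\mathbb H: 0\le \operatorname{Re}\tau\le 1,\ |\tau-\tfrac12|\ge\tfrac12\},\qquad F=\{\tau\in\mathbb H: 0\le\operatorname{Re}\tau\le1,\ |\tau|\ge1,\ |\tau-1|\ge1\}$$ be the basic fundamental domains of $\Gamma_0(2)$ and of $SL(2,\mathbb Z)$, let $F_0^{<}$ and $F_0^{>}$ be the sets of interior points $\tau$ of $F_0$ with $\operatorname{Re}\tau<\frac12$ and with $\operatorname{Re}\tau>\frac12$, respectively, and let $$\mathcal C_2=\{\tau\in F_0^{<}: f_C(\tau)=0\text{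 for some }C\in(0,+\infty)\},\qquad \mathcal C_3=\{\tau\in F_0^{>}: f_C(\tau)=0\text{ for some }C\in(-\infty,1)\},$$ $$\mathcal C_<=\mathcal C_2\cap F,\qquad \mathcal C_>=\mathcal C_3\cap F .$$ Let $\mathcal D\subset F$ be the set of all points of $F$ of the form $\gamma\cdot z$ with $\gamma\in SL(2,\mathbb Z)$ and $z\in\mathbb H$, $E_6'(z)=0$. Then: 1. There are points $\tau_1,\tau_0\in\partial F$ with $f_1(\tau_1)=0$ and $f_0(\tau_0)=0$ such that $\mathcal C_<$ is a single smooth simple curve with endpoints $\partial\mathcal C_<=\{\tau_1,\frac14+i\infty\}$ and $\mathcal C_>$ is a single smooth simple curve with endpoints $\partial\mathcal C_>=\{\tau_0,\frac34+i\infty\}$. That is, $\mathcal C_<$ is the image of an injective $C^\infty$ map $c:[0,\infty)\to\mathbb C$ with nowhere vanishing derivative, $c(0)=\tau_1$, $\operatorname{Re}c(t)\to\frac14$ and $\operatorname{Im}c(t)\to+\infty$ as $t\to\infty$; likewise $\mathcal C_>$ with $\tau_0$ and $\frac34$ in place of $\tau_1$ and $\frac14$. 2. $\mathcal C_<$ and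 $\mathcal C_>$ are disjoint, and $\mathcal D$ is a dense subset of their union; more precisely $$\mathcal D\subset\mathcal C_<\cup\mathcal C_>=\overline{\mathcal D}\cap F=\overline{\mathcal D}\setminus\{\infty\},$$ where $\overline{\mathcal D}$ is the closure of $\mathcal D$ in the Riemann sphere $\mathbb C\cup\{\infty\}$. -/

import Mathlib

open Set Filter Topology UpperHalfPlane
open scoped ContDiff MatrixGroups

noncomputable section

namespace E6Crit

/-- The invariant `g₂(τ) = (4π⁴/3) E₄(τ)` of the elliptic curve `ℂ / (ℤ + ℤτ)`. -/
def g₂ (τ : ℍ) : ℂ := 4 * (Real.pi : ℂ) ^ 4 / 3 * ModularForm.E₄ τ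

/-- The invariant `g₃(τ) = (8π⁶/27) E₆(τ)`. -/
def g₃ (τ : ℍ) : ℂ := 8 * (Real.pi : ℂ) ^ 6 / 27 * ModularForm.E₆ τ

/-- The quasi-period `η₁(τ) = (π²/3) E₂(τ)` of the Weierstrass zeta function. -/
def η₁ (τ : ℍ) : ℂ := (Real.pi : ℂ) ^ 2 / 3 * EisensteinSeries.E2 τ

/-- The quasi-period `η₂(τ) = τ η₁(τ) - 2πi`. -/
def η₂ (τ : ℍ) : ℂ := (τ : ℂ) * η₁ τ - 2 * (Real.pi : ℂ) * Complex.I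

/-- `f_C(τ) = (C - τ) g₂(τ)² - 18 (C η₁(τ) - η₂(τ)) g₃(τ)` for a real parameter `C`. -/
def f (C : ℝ) (τ : ℍ) : ℂ :=
  ((C : ℂ) - (τ : ℂ)) * g₂ τ ^ 2 - 18 * ((C : ℂ) * η₁ τ - η₂ τ) * g₃ τ

/-- The basic fundamental domain of `Γ₀(2)`. -/
def F₀ : Set ℍ :=
  {τ | 0 ≤ (τ : ℂ).re ∧ (τ : ℂ).re ≤ 1 ∧ 1 / 2 ≤ ‖(τ : ℂ) - 1 / 2‖}

/-- The open left half of `F₀`. -/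
def F₀Left : Set ℍ := {τ | τ ∈ interior F₀ ∧ (τ : ℂ).re < 1 / 2}

/-- The open right half of `F₀`. -/
def F₀Right : Set ℍ := {τ | τ ∈ interior F₀ ∧ 1 / 2 < (τ : ℂ).re}

/-- The basic fundamental domain of `SL(2,ℤ)`. -/
def F : Set ℍ :=
  {τ | 0 ≤ (τ : ℂ).re ∧ (τ : ℂ).re ≤ 1 ∧ 1 ≤ ‖(τ : ℂ)‖ ∧ 1 ≤ ‖(τ : ℂ) - 1‖}

/-- The curve `C₂`, traced by the zeros of `f_C` in the left half of `F₀` for `C ∈ (0, ∞)`. -/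
def C₂ : Set ℍ := {τ | τ ∈ F₀Left ∧ ∃ C : ℝ, 0 < C ∧ f C τ = 0}

/-- The curve `C₃`, traced by the zeros of `f_C` in the right half of `F₀` for `C ∈ (-∞, 1)`. -/
def C₃ : Set ℍ := {τ | τ ∈ F₀Right ∧ ∃ C : ℝ, C < 1 ∧ f C τ = 0}

/-- `C_< = C₂ ∩ F`. -/
def CLeft : Set ℍ := C₂ ∩ F

/-- `C_> = C₃ ∩ F`. -/
def CRight : Set ℍ := C₃ ∩ F

/-- The critical points of `E₆` in the upper half plane: the zeros of the complex derivative. -/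
def criticalPoints : Set ℍ :=
  {z | deriv (fun w : ℂ => ModularForm.E₆ (ofComplex w)) (z : ℂ) = 0}

/-- The points of `F` that are images of critical points of `E₆` under the Möbius action
of `SL(2,ℤ)`. -/
def D : Set ℍ := {τ | τ ∈ F ∧ ∃ z ∈ criticalPoints, ∃ γ : SL(2, ℤ), γ • z = τ}

/-- `S` is a single smooth simple curve which starts at the point `p` (belonging to `S`) and whose
other end is the cusp `x + i∞`: it has a smooth regular injective parametrization by `[0, ∞)`,
with value `p` at `0`, such that the real part tends to `x` and the imaginary part to `+∞`
at the open end of the parameter interval. -/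
def IsSmoothCurveToCusp (S : Set ℍ) (p : ℍ) (x : ℝ) : Prop :=
  ∃ c : ℝ → ℂ,
    ContDiffOn ℝ ∞ c (Ici 0) ∧
    (∀ t ∈ Ici (0 : ℝ), derivWithin c (Ici 0) t ≠ 0) ∧
    InjOn c (Ici 0) ∧
    c '' Ici 0 = ((↑) : ℍ → ℂ) '' S ∧
    c 0 = (p : ℂ) ∧
    Tendsto (fun t => (c t).re) atTop (𝓝 x) ∧
    Tendsto (fun t => (c t).im) atTop atTop

/-- The embedding of the upper half plane in the Riemann sphere `ℂ ∪ {∞}`. -/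
def toSphere (τ : ℍ) : OnePoint ℂ := ((τ : ℂ) : OnePoint ℂ)

end E6Crit

end

/-!
# The curves of real values of the equivariant function of `E₆`

With `h(z) = z + 6 E₆(z) / E₆'(z)`, Ramanujan's identity `E₄² - E₂ E₆ = -2 D E₆` turns the
equation `f_C(τ) = 0` into `h(τ) = C`. The function `h` satisfies `h(γz) = γ h(z)` for `γ` in
`SL(2, ℤ)` and takes the value `∞` exactly at the critical points of `E₆`. Hence a point of `F`
lies in `D` exactly when `h` is rational there, and `CLeft ∪ CRight` is the locus in `F` where `h`
is real. This locus is closed, and `D` is dense in it once `h` is known to be nowhere locally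
constant along it (`mem_D_iff`, `mem_union_iff`, `CLeft_subset_closure_D`).

The geometry of the locus comes from the shape of `h` near the cusp. With `q = exp(2πiz)`,
`h(z) = z + i / (168π) · (1/q - 570 + 20256 q + T(q))`, where the power series `T` starts in degree
two, has real coefficients, and is small on the disc `|q| ≤ 1/230`, which contains the image of `F`
(`quotient_eq`, `sum_quotCoeff_le`). For a power series with real coefficients the imaginary part
is bounded by a multiple of `Im q`, so that on `0 < Re z < 1/2`, `Im z ≥ √3/2` the terms in
`1/q` and `q` decide that `Re h > 0` and `Im h' < 0`; similarly `Im h > 0` on `Re z = 0` and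
`Im h < 0` on `Re z = 1/2`. Consequently `Im h` strictly decreases along horizontal segments and has
exactly one zero `x = X(y)` at every height `y`, smooth in `y` by the implicit function theorem.
As `h' ≠ 0`, the real function `y ↦ h(X(y) + iy)` is injective. On the unit circle `|h| = 1`, by
the equation `h(-1/z) = -1/h(z)` and the reality of the coefficients, so `h = 1` wherever the curve
meets the circle; by injectivity this happens only once, and the part of the curve in `F` is
`y ≥ y₁` (`exists_startHeight`). The right-hand curve is the mirror image under `τ ↦ 1 - τ̄`,
which replaces `h` by `1 - h̄`.
-/

noncomputable section

namespace E6Crit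

open Complex ComplexConjugate

/-! ### Power series, `q`-expansions and Ramanujan's identity for `E₆` -/

section

open ModularForm EisensteinSeries Derivative Function
open scoped ArithmeticFunction.sigma Manifold ModularForm

lemma summable_norm_mul_pow {a : ℕ → ℂ} {ρ : ℝ} (ha : Summable fun n => ‖a n‖ * ρ ^ n) {q : ℂ}
    (hq : ‖q‖ ≤ ρ) : Summable fun n => ‖a n * q ^ n‖ := by
  refine ha.of_nonneg_of_le (fun n => norm_nonneg _) fun n => ?_
  rw [norm_mul, norm_pow]
  gcongr

lemma differentiableAt_tsum_mul_pow {a : ℕ → ℂ} {ρ : ℝ} (ha : Summable fun n => ‖a n‖ * ρ ^ n)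
    {q : ℂ} (hq : ‖q‖ < ρ) : DifferentiableAt ℂ (fun w => ∑' n, a n * w ^ n) q := by
  have hd : DifferentiableOn ℂ (fun w => ∑' n, a n * w ^ n) (Metric.ball 0 ρ) := by
    refine differentiableOn_tsum_of_summable_norm ha (fun n => by fun_prop) Metric.isOpen_ball ?_
    intro n w hw
    rw [norm_mul, norm_pow]
    gcongr
    exact (mem_ball_zero_iff.mp hw).le
  exact hd.differentiableAt (Metric.isOpen_ball.mem_nhds (mem_ball_zero_iff.mpr hq))

lemma hasSum_deriv_tsum_mul_pow {a : ℕ → ℂ} {ρ : ℝ} (ha : Summable fun n => ‖a n‖ * ρ ^ n)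
    {q : ℂ} (hq : ‖q‖ < ρ) :
    HasSum (fun n : ℕ => a n * (n * q ^ (n - 1))) (deriv (fun w => ∑' n, a n * w ^ n) q) := by
  have := hasSum_deriv_of_summable_norm (F := fun (n : ℕ) (w : ℂ) => a n * w ^ n) ha
    (fun n => by fun_prop) (Metric.isOpen_ball (x := (0 : ℂ)) (ε := ρ))
    (fun n w hw => by
      rw [norm_mul, norm_pow]
      gcongr
      exact (mem_ball_zero_iff.mp hw).le) (mem_ball_zero_iff.mpr hq)
  simpa using this

/-- The nome `q = exp(2πiz)`. -/
def nome (z : ℂ) : ℂ := cexp (2 * Real.pi * Complex.I * z)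

lemma nome_ne_zero (z : ℂ) : nome z ≠ 0 := Complex.exp_ne_zero _

lemma norm_nome (z : ℂ) : ‖nome z‖ = Real.exp (-(2 * Real.pi * z.im)) := by
  rw [nome, Complex.norm_exp]
  simp

lemma norm_nome_lt_one {z : ℂ} (hz : 0 < z.im) : ‖nome z‖ < 1 := by
  rw [norm_nome, Real.exp_lt_one_iff]
  have := Real.pi_pos
  have : 0 < 2 * Real.pi * z.im := by positivity
  linarith

lemma hasDerivAt_nome (z : ℂ) : HasDerivAt nome (2 * Real.pi * Complex.I * nome z) z := by
  have := ((hasDerivAt_id z).const_mul (2 * Real.pi * Complex.I)).cexp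
  convert! this using 1
  simp [nome, mul_comm]

lemma nome_eq_qParam (z : ℂ) : Periodic.qParam 1 z = nome z := by
  simp [Periodic.qParam, nome]

/-- The coefficients `σ₅(n)` of `(1 - E₆) / 504`. -/
def sig (n : ℕ) : ℝ := (ArithmeticFunction.sigma 5 n : ℕ)

lemma sig_nonneg (n : ℕ) : 0 ≤ sig n := Nat.cast_nonneg _

lemma sig_zero : sig 0 = 0 := by simp [sig]

lemma sig_le (n : ℕ) : sig n ≤ (n : ℝ) ^ 6 := by
  rw [sig]; exact_mod_cast ArithmeticFunction.sigma_le_pow_succ 5 n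

/-- The coefficients `n σ₅(n)` of the `q`-derivative of `E₆`, up to the factor `-504`. -/
def nu (n : ℕ) : ℝ := n * sig n

lemma nu_nonneg (n : ℕ) : 0 ≤ nu n := mul_nonneg (Nat.cast_nonneg _) (sig_nonneg n)

lemma nu_zero : nu 0 = 0 := by simp [nu]

lemma nu_le (n : ℕ) : nu n ≤ (n : ℝ) ^ 7 := by
  have := mul_le_mul_of_nonneg_left (sig_le n) (Nat.cast_nonneg (α := ℝ) n)
  rw [nu]; calc _ ≤ _ := this
    _ = _ := by ring

lemma summable_sig {r : ℝ} (h0 : 0 ≤ r) (h1 : r < 1) : Summable fun n => sig n * r ^ n := by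
  refine (summable_pow_mul_geometric_of_norm_lt_one (r := r) 6
    (by rwa [Real.norm_of_nonneg h0])).of_nonneg_of_le
    (fun n => mul_nonneg (sig_nonneg n) (by positivity)) fun n => ?_
  gcongr
  exact sig_le n

lemma summable_nu {r : ℝ} (h0 : 0 ≤ r) (h1 : r < 1) : Summable fun n => nu n * r ^ n := by
  refine (summable_pow_mul_geometric_of_norm_lt_one (r := r) 7
    (by rwa [Real.norm_of_nonneg h0])).of_nonneg_of_le
    (fun n => mul_nonneg (nu_nonneg n) (by positivity)) fun n => ?_
  gcongr
  exact nu_le n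

lemma summable_norm_sig {ρ : ℝ} (h0 : 0 ≤ ρ) (h1 : ρ < 1) :
    Summable fun n => ‖(sig n : ℂ)‖ * ρ ^ n := by
  simpa [abs_of_nonneg (sig_nonneg _)] using summable_sig h0 h1

/-- The power series `∑ σ₅(n) qⁿ`. -/
def sigSeries (q : ℂ) : ℂ := ∑' n, (sig n : ℂ) * q ^ n

/-- The power series `∑ n σ₅(n) qⁿ`. -/
def nuSeries (q : ℂ) : ℂ := ∑' n, (nu n : ℂ) * q ^ n

lemma hasSum_sigSeries {q : ℂ} (hq : ‖q‖ < 1) :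
    HasSum (fun n => (sig n : ℂ) * q ^ n) (sigSeries q) :=
  (summable_norm_mul_pow (summable_norm_sig (norm_nonneg q) hq) le_rfl).of_norm.hasSum

lemma hasSum_nuSeries {q : ℂ} (hq : ‖q‖ < 1) :
    HasSum (fun n => (nu n : ℂ) * q ^ n) (nuSeries q) := by
  have h : Summable fun n => ‖(nu n : ℂ)‖ * ‖q‖ ^ n := by
    simpa [abs_of_nonneg (nu_nonneg _)] using summable_nu (norm_nonneg q) hq
  exact (summable_norm_mul_pow h le_rfl).of_norm.hasSum

/-- The Euler operator `q d/dq` maps `∑ σ₅(n) qⁿ` to `∑ n σ₅(n) qⁿ`. -/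
lemma hasDerivAt_sigSeries {q : ℂ} (hq : ‖q‖ < 1) :
    ∃ d, HasDerivAt sigSeries d q ∧ q * d = nuSeries q := by
  obtain ⟨ρ, h1, h2⟩ := exists_between hq
  have ha := summable_norm_sig ((norm_nonneg q).trans h1.le) h2
  refine ⟨_, (differentiableAt_tsum_mul_pow ha h1).hasDerivAt, ?_⟩
  have := (hasSum_deriv_tsum_mul_pow ha h1).mul_left q
  refine this.unique ?_
  convert! hasSum_nuSeries hq using 2 with n
  rcases n with _ | n
  · simp [nu_zero]
  · simp only [nu, Nat.add_sub_cancel]; push_cast; ring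

lemma E₆_eq (τ : ℍ) : E₆ τ = 1 - 504 * sigSeries (nome τ) := by
  have h : HasSum (fun m => (qExpansion 1 E₆).coeff m • Periodic.qParam (1 : ℝ) τ ^ m) (E₆ τ) :=
    ModularForm.hasSum_qExpansion (f := E₆) one_pos one_mem_strictPeriods_SL τ
  have h2 := ((hasSum_sigSeries (norm_nome_lt_one τ.im_pos)).mul_left (-504))
  have h3 : HasSum (fun n : ℕ => if n = 0 then (1 : ℂ) else 0) 1 := hasSum_ite_eq 0 1
  have h4 := h3.add h2
  refine (h.unique ?_).trans (b := 1 + -504 * sigSeries (nome τ)) (by ring)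
  convert! h4 using 2 with n
  rw [E_qExpansion_coeff _ ⟨3, rfl⟩, nome_eq_qParam]
  rcases n with _ | n
  · simp [sig_zero]
  · norm_num [show bernoulli 6 = 1 / 42 by decide +kernel, sig]
    ring

lemma normalizedDeriv_E₆ (τ : ℍ) :
    normalizedDerivOfComplex E₆ τ = -504 * nuSeries (nome τ) := by
  obtain ⟨d, hd, hd'⟩ := hasDerivAt_sigSeries (norm_nome_lt_one τ.im_pos)
  have h1 : HasDerivAt (fun z => 1 - 504 * sigSeries (nome z))
      (-(504 * (d * (2 * Real.pi * Complex.I * nome τ)))) (τ : ℂ) :=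
    ((hd.comp (τ : ℂ) (hasDerivAt_nome τ)).const_mul 504).const_sub 1
  have h2 : (E₆ ∘ ofComplex) =ᶠ[𝓝 (τ : ℂ)] fun z => 1 - 504 * sigSeries (nome z) := by
    filter_upwards [isOpen_upperHalfPlaneSet.mem_nhds τ.im_pos] with w hw
    rw [comp_apply, E₆_eq, ofComplex_apply_of_im_pos hw]
  rw [normalizedDerivOfComplex, (h1.congr_of_eventuallyEq h2).deriv, ← hd']
  have := Real.pi_ne_zero
  field_simp

/-- A function with a `q`-expansion tends to the constant term at `i∞`. -/
lemma tendsto_atImInfty_of_hasSum {F : ℍ → ℂ} {c : ℕ → ℂ}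
    (hF : ∀ τ : ℍ, HasSum (fun m => c m • Periodic.qParam (1 : ℝ) τ ^ m) (F τ)) :
    Tendsto F atImInfty (𝓝 (c 0)) := by
  have hq0 (τ : ℍ) : Periodic.qParam (1 : ℝ) (τ : ℂ) ≠ 0 := by
    rw [nome_eq_qParam]; exact nome_ne_zero _
  -- `(F - c 0) / q` has a `q`-expansion too, so it is bounded at `i∞`
  have h1 (τ : ℍ) : HasSum (fun m => c (m + 1) • Periodic.qParam (1 : ℝ) τ ^ m)
      ((F τ - c 0) / Periodic.qParam (1 : ℝ) τ) := by
    have h := ((hasSum_nat_add_iff' 1).mpr (hF τ)).div_const (Periodic.qParam (1 : ℝ) (τ : ℂ))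
    convert! h using 2 with m
    · simp only [smul_eq_mul]; field_simp [hq0 τ]; ring
    · simp
  have h2 : IsBoundedAtImInfty fun τ : ℍ => (F τ - c 0) / Periodic.qParam (1 : ℝ) τ :=
    isBoundedAtImInfty_of_hasSum_qExpansion one_pos h1
  have h3 : Tendsto (fun τ : ℍ => Periodic.qParam (1 : ℝ) τ) atImInfty (𝓝 0) :=
    qParam_tendsto_atImInfty one_pos
  have h4 : Tendsto (fun τ : ℍ => F τ - c 0) atImInfty (𝓝 0) := by
    have := h3.zero_mul_isBoundedUnder_le h2.isBoundedUnder_le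
    refine this.congr fun τ => ?_
    field_simp [hq0 τ]
  simpa using h4.add_const (c 0)

lemma tendsto_E_atImInfty {k : ℕ} (hk : 3 ≤ k) (hk2 : Even k) :
    Tendsto (E hk) atImInfty (𝓝 1) := by
  have := tendsto_atImInfty_of_hasSum
    (ModularForm.hasSum_qExpansion (f := E hk) one_pos one_mem_strictPeriods_SL)
  rwa [E_qExpansion_coeff_zero hk hk2] at this

lemma tendsto_E2_atImInfty : Tendsto E2 atImInfty (𝓝 1) := by
  have := tendsto_atImInfty_of_hasSum (F := E2)
    (c := fun m => if m = 0 then 1 else -24 * (ArithmeticFunction.sigma 1 m : ℂ)) (fun τ => by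
      simpa only [Function.Periodic.qParam, ofReal_one, div_one] using hasSum_qExpansion_E2 (z := τ))
  simpa using this

lemma tendsto_normalizedDeriv_E₆_atImInfty :
    Tendsto (normalizedDerivOfComplex E₆) atImInfty (𝓝 0) := by
  have := tendsto_atImInfty_of_hasSum (F := normalizedDerivOfComplex E₆)
    (c := fun m => -504 * (nu m : ℂ)) (fun τ => by
      rw [normalizedDeriv_E₆]
      convert! (hasSum_nuSeries (norm_nome_lt_one τ.im_pos)).mul_left (-504) using 2 with n
      rw [nome_eq_qParam, smul_eq_mul, mul_assoc])
  simpa [nu_zero] using this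

/-- The difference `D E₆ - (E₂ E₆ - E₄²) / 2` of the two sides of Ramanujan's identity. -/
def ramanujanDefectFun : ℍ → ℂ := serreDerivative 6 E₆ + (1 / 2 : ℂ) • (E₄ * E₄ : ℍ → ℂ)

lemma ramanujanDefectFun_slash (γ : SL(2, ℤ)) :
    ramanujanDefectFun ∣[(8 : ℤ)] γ = ramanujanDefectFun := by
  have h1 : (serreDerivative 6 E₆) ∣[(8 : ℤ)] γ = serreDerivative 6 E₆ := by
    have := serreDerivative_slash_invariant (k := 6) (F := E₆) (ModularFormClass.holo E₆)
      (γ := γ) (E₆.slash_action_eq' _ ⟨γ, rfl⟩)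
    simpa using! this
  have h2 : (E₄ * E₄ : ℍ → ℂ) ∣[(8 : ℤ)] γ = E₄ * E₄ := by
    have h := ModularForm.mul_slash_SL2 4 4 γ E₄ E₄
    have h4 : (E₄ : ℍ → ℂ) ∣[(4 : ℤ)] γ = E₄ := E₄.slash_action_eq' _ ⟨γ, rfl⟩
    rw [h4] at h
    exact h
  rw [ramanujanDefectFun, SlashAction.add_slash, h1, ModularForm.SL_smul_slash, h2]

lemma isZeroAtImInfty_ramanujanDefectFun : IsZeroAtImInfty ramanujanDefectFun := by
  have h4 := tendsto_E_atImInfty (by norm_num : 3 ≤ 4) ⟨2, rfl⟩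
  have h6 := tendsto_E_atImInfty (by norm_num : 3 ≤ 6) ⟨3, rfl⟩
  have := (tendsto_normalizedDeriv_E₆_atImInfty.sub
    ((tendsto_E2_atImInfty.const_mul (6 * 12⁻¹)).mul h6)).add ((h4.mul h4).const_mul (1 / 2))
  norm_num at this
  refine this.congr fun τ => ?_
  simp [ramanujanDefectFun]
  norm_num

/-- The function `ramanujanDefectFun` as a cusp form of weight `8` and level one. -/
def ramanujanDefect : CuspForm 𝒮ℒ 8 where
  toFun := ramanujanDefectFun
  slash_action_eq' := by
    rintro _ ⟨γ, rfl⟩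
    exact ramanujanDefectFun_slash γ
  holo' := by
    have h6 : MDiff (E₆ : ℍ → ℂ) := ModularFormClass.holo E₆
    have h4 : MDiff (E₄ : ℍ → ℂ) := ModularFormClass.holo E₄
    exact (serreDerivative_mdifferentiable 6 h6).add ((h4.mul h4).const_smul _)
  zero_at_cusps' := by
    intro c hc
    rw [Subgroup.IsArithmetic.isCusp_iff_isCusp_SL2Z] at hc
    rw [OnePoint.isZeroAt_iff_forall_SL2Z hc]
    intro γ _
    rw [ramanujanDefectFun_slash]
    exact isZeroAtImInfty_ramanujanDefectFun

/-- Ramanujan's identity `D E₆ = (E₂ E₆ - E₄²) / 2`, where `D E₆ = -504 ∑ n σ₅(n) qⁿ`. The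
difference of the two sides is a level one cusp form of weight `8`, and there is none but `0`. -/
lemma ramanujan (τ : ℍ) : E₄ τ ^ 2 - E2 τ * E₆ τ = 1008 * nuSeries (nome τ) := by
  have h : ramanujanDefect = 0 :=
    rank_zero_iff_forall_zero.mp (CuspForm.rank_eq_zero_of_weight_lt_twelve (by norm_num)) _
  have h2 : serreDerivative 6 E₆ τ + (1 / 2 : ℂ) * (E₄ τ * E₄ τ) = 0 := by
    change ramanujanDefect τ = 0
    rw [h]; rfl
  rw [serreDerivative_apply, normalizedDeriv_E₆] at h2
  linear_combination 2 * h2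

/-! ### The equivariant function and its modular transformation -/

/-- The equivariant function `h(z) = z + 6 E₆(z) / E₆'(z)`, written through the `q`-expansions
of `E₆` and of its derivative, so that it is defined as a function of a complex variable. At a
critical point of `E₆`, a pole of `h`, its value is the junk value `z`. -/
def equivariant (z : ℂ) : ℂ :=
  z + Complex.I / (168 * Real.pi) * ((1 - 504 * sigSeries (nome z)) / nuSeries (nome z))

lemma f_eq (C : ℝ) (τ : ℍ) :
    f C τ = 16 * (Real.pi : ℂ) ^ 8 / 9 * ((C - τ) * (1008 * nuSeries (nome τ)) -
      6 * Complex.I / Real.pi * E₆ τ) := by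
  have := Real.pi_ne_zero
  rw [← ramanujan, f, g₂, g₃, η₂, η₁]
  field_simp
  ring

/-- The zeros of `f_C` are the points where the equivariant function takes the value `C`. -/
lemma f_eq_zero_iff (C : ℝ) {τ : ℍ} (hν : nuSeries (nome τ) ≠ 0) :
    f C τ = 0 ↔ equivariant τ = C := by
  have hpi : (Real.pi : ℂ) ≠ 0 := by exact_mod_cast Real.pi_ne_zero
  have h1 : (16 * (Real.pi : ℂ) ^ 8 / 9) ≠ 0 := by simp [hpi]
  rw [f_eq, mul_eq_zero, or_iff_right h1, equivariant, ← E₆_eq]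
  constructor
  · intro h
    field_simp at h ⊢
    linear_combination -h / 6
  · intro h
    rw [← h]
    field_simp
    ring

lemma mem_criticalPoints_iff (z : ℍ) : z ∈ criticalPoints ↔ nuSeries (nome z) = 0 := by
  have h := normalizedDeriv_E₆ z
  rw [normalizedDerivOfComplex] at h
  have h0 := two_pi_I_ne_zero
  change deriv (E₆ ∘ ofComplex) (z : ℂ) = 0 ↔ _
  constructor <;> intro h1
  · rw [h1] at h
    simpa using h.symm
  · rw [h1] at h
    simpa [h0] using h

lemma E₆_slash (γ : SL(2, ℤ)) : (E₆ : ℍ → ℂ) ∣[(6 : ℤ)] γ = E₆ :=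
  E₆.slash_action_eq' _ ⟨γ, rfl⟩

lemma E₆_smul (γ : SL(2, ℤ)) (τ : ℍ) : E₆ (γ • τ) = denom γ τ ^ 6 * E₆ τ := by
  have h := congrFun (E₆_slash γ) τ
  have hd : denom γ τ ≠ 0 := denom_ne_zero _ _
  rw [ModularForm.SL_slash_apply] at h
  rw [← h, zpow_neg]
  field_simp

lemma nuSeries_smul (γ : SL(2, ℤ)) (τ : ℍ) :
    nuSeries (nome ↑(γ • τ)) = denom γ τ ^ 7 *
      (denom γ τ * nuSeries (nome τ) + Complex.I / (168 * Real.pi) * γ 1 0 * E₆ τ) := by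
  have h := congrFun (normalizedDerivOfComplex_SL_slash (k := 6) (F := E₆)
    (ModularFormClass.holo E₆) (γ := γ)) τ
  rw [E₆_slash γ] at h
  have hd : denom γ τ ≠ 0 := denom_ne_zero _ _
  have hpi : (Real.pi : ℂ) ≠ 0 := by exact_mod_cast Real.pi_ne_zero
  rw [Pi.sub_apply, ModularForm.SL_slash_apply, normalizedDeriv_E₆, normalizedDeriv_E₆,
    show (-(6 + 2 : ℤ)) = -(8 : ℕ) by norm_num, zpow_neg, zpow_natCast] at h
  field_simp at h ⊢
  push_cast at h
  linear_combination (-Complex.I / 6) * h + 168 * Real.pi * (nuSeries (nome ↑(γ • τ)) -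
    nuSeries (nome τ) * denom γ τ ^ 8) * I_sq

/-- A point is equivalent under the modular group to a critical point of `E₆` exactly when the
equivariant function is rational there: `h(γz) = γh(z)` and `h = ∞` at the critical points. -/
lemma exists_criticalPoint_iff {τ : ℍ} (hν : nuSeries (nome τ) ≠ 0) :
    (∃ z ∈ criticalPoints, ∃ γ : SL(2, ℤ), γ • z = τ) ↔ ∃ r : ℚ, equivariant τ = r := by
  have key (γ : SL(2, ℤ)) : γ • τ ∈ criticalPoints ↔ γ 1 0 * equivariant τ + γ 1 1 = 0 := by
    have hd : denom γ τ ≠ 0 := denom_ne_zero _ _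
    rw [mem_criticalPoints_iff, nuSeries_smul, mul_eq_zero, or_iff_right (pow_ne_zero _ hd),
      equivariant, ← E₆_eq]
    have : denom γ τ * nuSeries (nome τ) + Complex.I / (168 * Real.pi) * γ 1 0 * E₆ τ =
        nuSeries (nome τ) * (γ 1 0 * (τ + Complex.I / (168 * Real.pi) *
          (E₆ τ / nuSeries (nome τ))) + γ 1 1) := by
      rw [ModularGroup.denom_apply]
      field_simp
      ring
    rw [this, mul_eq_zero, or_iff_right hν]
  constructor
  · rintro ⟨z, hz, γ, rfl⟩
    have h := (key γ⁻¹).mp (by simpa using hz)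
    have hc : (γ⁻¹ : SL(2, ℤ)) 1 0 ≠ 0 := by
      intro hc
      have hdet := (γ⁻¹).det_coe
      rw [Matrix.det_fin_two, hc] at hdet
      rw [hc] at h
      have : (γ⁻¹ : SL(2, ℤ)) 1 1 = 0 := by simpa using h
      rw [this] at hdet
      simp at hdet
    have hc' : (((γ⁻¹ : SL(2, ℤ)) 1 0 : ℤ) : ℂ) ≠ 0 := by exact_mod_cast hc
    refine ⟨-((γ⁻¹ : SL(2, ℤ)) 1 1 : ℚ) / ((γ⁻¹ : SL(2, ℤ)) 1 0 : ℚ), ?_⟩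
    push_cast
    rw [eq_div_iff hc']
    linear_combination h
  · rintro ⟨r, hr⟩
    have hco : IsCoprime ((r.den : ℤ)) (-r.num) := by
      have := r.reduced
      rw [IsCoprime.neg_right_iff, Int.isCoprime_iff_nat_coprime]
      simpa using this.symm
    obtain ⟨γ, -, hγ⟩ := ModularGroup.bottom_row_surj (R := ℤ)
      (show ![(r.den : ℤ), -r.num] ∈ {cd : Fin 2 → ℤ | IsCoprime (cd 0) (cd 1)} by simpa using hco)
    have h10 : γ 1 0 = r.den := by simpa using congrFun hγ 0
    have h11 : γ 1 1 = -r.num := by simpa using congrFun hγ 1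
    refine ⟨γ • τ, (key γ).mpr ?_, γ⁻¹, by simp⟩
    rw [h10, h11, hr]
    have := r.den_ne_zero
    nth_rewrite 2 [← Rat.num_div_den r]
    push_cast
    field_simp
    simp

/-- The equivariance `h(-1/τ) = -1 / h(τ)`, away from the poles of `h` at `τ` and `-1/τ`. -/
lemma equivariant_S (τ : ℍ) (hν : nuSeries (nome τ) ≠ 0)
    (hν' : nuSeries (nome ↑(ModularGroup.S • τ)) ≠ 0) :
    equivariant ↑(ModularGroup.S • τ) * equivariant τ = -1 := by
  have hτ := τ.ne_zero
  have h2 := nuSeries_smul ModularGroup.S τ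
  have h1 := E₆_smul ModularGroup.S τ
  have hd : denom ModularGroup.S τ = τ := by rw [ModularGroup.denom_apply]; simp [ModularGroup.S]
  have hc : (ModularGroup.S 1 0 : ℤ) = 1 := by simp [ModularGroup.S]
  rw [hd] at h1 h2
  rw [hc] at h2
  have hS : ((ModularGroup.S • τ : ℍ) : ℂ) = -1 / τ := by
    rw [modular_S_smul]; simp [neg_div]
  have hpi : (Real.pi : ℂ) ≠ 0 := by exact_mod_cast Real.pi_ne_zero
  rw [h2] at hν'
  have hN : (τ : ℂ) * nuSeries (nome τ) + Complex.I / (168 * Real.pi) * (1 : ℤ) * E₆ τ ≠ 0 :=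
    right_ne_zero_of_mul hν'
  rw [equivariant, equivariant, ← E₆_eq, ← E₆_eq, h1, h2, hS]
  generalize E₆ τ = e at *
  generalize nuSeries (nome τ) = n at *
  push_cast at hN ⊢
  generalize hk : Complex.I / (168 * Real.pi) = k at *
  rw [mul_one] at hN ⊢
  field_simp
  ring

end

/-! ### The Laurent expansion of the equivariant function at the cusp -/

lemma sig_values : sig 1 = 1 ∧ sig 2 = 33 ∧ sig 3 = 244 ∧ sig 4 = 1057 ∧ sig 5 = 3126 := by
  simp only [sig]
  norm_cast

lemma nu_le_ten_pow (n : ℕ) : nu n ≤ 10 ^ n := by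
  obtain ⟨h1, h2, h3, h4, -⟩ := sig_values
  rcases lt_or_ge n 5 with h | h
  · interval_cases n <;> norm_num [nu, h1, h2, h3, h4]
  · refine (nu_le n).trans ?_
    induction n, h using Nat.le_induction with
    | base => norm_num
    | succ n hn ih =>
      have h5 : (5 : ℝ) ≤ n := by exact_mod_cast hn
      have : ((n + 1 : ℕ) : ℝ) ≤ 6 / 5 * n := by push_cast; linarith
      calc ((n + 1 : ℕ) : ℝ) ^ 7 ≤ (6 / 5 * n) ^ 7 := by gcongr
        _ = (6 / 5) ^ 7 * (n : ℝ) ^ 7 := by ring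
        _ ≤ 10 * (n : ℝ) ^ 7 := by gcongr; norm_num
        _ ≤ 10 * 10 ^ n := by gcongr
        _ = 10 ^ (n + 1) := by ring

lemma sig_le_ten_pow (n : ℕ) : sig n ≤ 10 ^ n := by
  rcases n with _ | n
  · simp [sig_zero]
  · refine le_trans ?_ (nu_le_ten_pow _)
    rw [nu]
    refine le_mul_of_one_le_left (sig_nonneg _) ?_
    push_cast
    linarith [n.cast_nonneg (α := ℝ)]

/-- The coefficients of the numerator `(1 - 504 ∑ σ₅(n)qⁿ - (1 - 570q + 20256q²) P(q)) / q³`,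
where `P(q) = ∑ (n + 1) σ₅(n + 1) qⁿ`. The polynomial is the quotient
`(1 - 504 ∑ σ₅(n)qⁿ) / P(q)` up to order two. -/
def remCoeff (n : ℕ) : ℝ :=
  -504 * sig (n + 3) - nu (n + 4) + 570 * nu (n + 3) - 20256 * nu (n + 2)

/-- The power series coefficients `K` with `K · P = M`, where `M` has coefficients `remCoeff`
and `P` has coefficients `(n + 1) σ₅(n + 1)`. -/
def quotCoeff (n : ℕ) : ℝ :=
  (PowerSeries.mk remCoeff * (PowerSeries.mk fun n => nu (n + 1))⁻¹).coeff n

lemma nu_one : nu 1 = 1 := by simp [nu, sig_values.1]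

lemma sum_quotCoeff_mul (n : ℕ) :
    ∑ p ∈ Finset.HasAntidiagonal.antidiagonal n, quotCoeff p.1 * nu (p.2 + 1) = remCoeff n := by
  have h : (PowerSeries.mk remCoeff * (PowerSeries.mk fun n => nu (n + 1))⁻¹) *
      (PowerSeries.mk fun n => nu (n + 1)) = PowerSeries.mk remCoeff := by
    rw [mul_assoc, PowerSeries.inv_mul_cancel, mul_one]
    rw [← PowerSeries.coeff_zero_eq_constantCoeff_apply, PowerSeries.coeff_mk, nu_one]
    exact one_ne_zero
  have := congrArg (PowerSeries.coeff n) h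
  rw [PowerSeries.coeff_mul, PowerSeries.coeff_mk] at this
  simpa [quotCoeff] using this

lemma abs_remCoeff_le (n : ℕ) : |remCoeff n| ≤ 3109600 * 10 ^ n := by
  have h1 := sig_le_ten_pow (n + 3)
  have h2 := nu_le_ten_pow (n + 4)
  have h3 := nu_le_ten_pow (n + 3)
  have h4 := nu_le_ten_pow (n + 2)
  have k1 := sig_nonneg (n + 3)
  have k2 := nu_nonneg (n + 4)
  have k3 := nu_nonneg (n + 3)
  have k4 := nu_nonneg (n + 2)
  have := pow_pos (show (0 : ℝ) < 10 by norm_num) n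
  simp only [pow_succ] at h1 h2 h3 h4
  rw [remCoeff, abs_le]
  constructor <;> linarith

lemma summable_remCoeff : Summable fun n => |remCoeff n| * (1 / 133) ^ n := by
  refine ((summable_geometric_of_lt_one (r := 10 / 133) (by norm_num) (by norm_num)).mul_left
    3109600).of_nonneg_of_le (fun n => by positivity) fun n => ?_
  calc |remCoeff n| * (1 / 133) ^ n ≤ 3109600 * 10 ^ n * (1 / 133) ^ n := by
        gcongr; exact abs_remCoeff_le n
    _ = 3109600 * (10 / 133) ^ n := by rw [mul_assoc, ← mul_pow]; norm_num

/-- The first two coefficients are computed, the others are bounded by a geometric series. -/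
lemma tsum_remCoeff_le : ∑' n, |remCoeff n| * (1 / 133) ^ n ≤ 1163400 := by
  obtain ⟨h1, h2, h3, h4, h5⟩ := sig_values
  have e0 : |remCoeff 0| = 1046860 := by norm_num [remCoeff, nu, h2, h3, h4]
  have e1 : |remCoeff 1| = 12965790 := by norm_num [remCoeff, nu, h3, h4, h5]
  have hg := (summable_geometric_of_lt_one (r := 10 / 133) (by norm_num) (by norm_num)).mul_left
    (3109600 * (10 / 133 : ℝ) ^ 2)
  rw [← summable_remCoeff.sum_add_tsum_nat_add 2, Finset.sum_range_succ, Finset.sum_range_one,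
    e0, e1]
  have : ∑' n, |remCoeff (n + 2)| * (1 / 133) ^ (n + 2) ≤
      ∑' n : ℕ, 3109600 * (10 / 133 : ℝ) ^ 2 * (10 / 133) ^ n := by
    refine ((summable_nat_add_iff 2).mpr summable_remCoeff).tsum_le_tsum (fun n => ?_) hg
    calc |remCoeff (n + 2)| * (1 / 133) ^ (n + 2)
        ≤ 3109600 * 10 ^ (n + 2) * (1 / 133) ^ (n + 2) := by gcongr; exact abs_remCoeff_le _
      _ = 3109600 * (10 / 133) ^ 2 * (10 / 133) ^ n := by
        rw [mul_assoc, ← mul_pow]; norm_num [pow_add]; ring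
  rw [tsum_mul_left, tsum_geometric_of_lt_one (by norm_num) (by norm_num)] at this
  norm_num at this ⊢
  linarith

lemma summable_nu_succ : Summable fun n => nu (n + 1) * (1 / 133) ^ n := by
  have := (summable_nat_add_iff 1).mpr (summable_nu (r := 1 / 133) (by norm_num) (by norm_num))
  refine (this.mul_left 133).congr fun n => ?_
  rw [pow_succ]; ring

lemma tsum_nu_succ_le : ∑' n, nu (n + 2) * (1 / 133) ^ (n + 1) ≤ 54 / 100 := by
  obtain ⟨h1, h2, h3, h4, h5⟩ := sig_values
  have hs : Summable fun n => nu (n + 2) * (1 / 133) ^ (n + 1) :=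
    (summable_nat_add_iff 1).mpr summable_nu_succ
  have hg := (summable_geometric_of_lt_one (r := 10 / 133) (by norm_num) (by norm_num)).mul_left
    (10 * (10 / 133 : ℝ) ^ 4)
  rw [← hs.sum_add_tsum_nat_add 3]
  have : ∑' n, nu (n + 3 + 2) * (1 / 133) ^ (n + 3 + 1) ≤
      ∑' n : ℕ, 10 * (10 / 133 : ℝ) ^ 4 * (10 / 133) ^ n := by
    refine ((summable_nat_add_iff 3).mpr hs).tsum_le_tsum (fun n => ?_) hg
    calc nu (n + 3 + 2) * (1 / 133) ^ (n + 3 + 1)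
        ≤ 10 ^ (n + 3 + 2) * (1 / 133) ^ (n + 3 + 1) := by gcongr; exact nu_le_ten_pow _
      _ = 10 * (10 / 133 : ℝ) ^ 4 * (10 / 133) ^ n := by
        rw [pow_succ, mul_right_comm, ← mul_pow]; norm_num [pow_add]; ring
  rw [tsum_mul_left, tsum_geometric_of_lt_one (by norm_num) (by norm_num)] at this
  norm_num [Finset.sum_range_succ, nu, h2, h3, h4] at this ⊢
  linarith

/-- The part of a Cauchy product of degree `< N` is bounded by the product of the partial sums. -/
lemma sum_range_sum_antidiagonal_le {a b : ℕ → ℝ} (ha : ∀ n, 0 ≤ a n) (hb : ∀ n, 0 ≤ b n) (N : ℕ) :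
    ∑ n ∈ Finset.range N, ∑ p ∈ Finset.HasAntidiagonal.antidiagonal n, a p.1 * b p.2 ≤
      (∑ n ∈ Finset.range N, a n) * ∑ n ∈ Finset.range N, b n := by
  rw [Finset.sum_mul_sum, ← Finset.sum_product', ← Finset.sum_biUnion]
  · refine Finset.sum_le_sum_of_subset_of_nonneg ?_ fun p _ _ => mul_nonneg (ha _) (hb _)
    intro p hp
    simp only [Finset.mem_biUnion, Finset.mem_range, Finset.HasAntidiagonal.mem_antidiagonal] at hp
    simp only [Finset.mem_product, Finset.mem_range]
    omega
  · intro m _ n _ hmn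
    rw [Function.onFun, Finset.disjoint_left]
    intro p hp hp'
    rw [Finset.HasAntidiagonal.mem_antidiagonal] at hp hp'
    exact hmn (hp.symm.trans hp')

/-- The recursion `K = M - (P - 1) K` bounds the partial sums `S` of `∑ |K n| (1/133)ⁿ` by
`S ≤ ‖M‖ + ‖P - 1‖ S`. The radius `1/133` exceeds `1/230`, an upper bound for `|q|` on the
fundamental domain, by enough to absorb two derivatives, while `‖P - 1‖ ≤ 0.54` still holds. -/
lemma sum_quotCoeff_le (N : ℕ) :
    ∑ n ∈ Finset.range N, |quotCoeff n| * (1 / 133) ^ n ≤ 2530000 := by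
  set a : ℕ → ℝ := fun n => |quotCoeff n| * (1 / 133) ^ n with ha
  -- the coefficients of `P - 1`
  set b : ℕ → ℝ := fun n => (if n = 0 then 0 else nu (n + 1)) * (1 / 133) ^ n with hb
  have ha0 (n) : 0 ≤ a n := by positivity
  have hb0 (n) : 0 ≤ b n := by
    have := nu_nonneg (n + 1)
    simp only [hb]; split_ifs <;> positivity
  have h1 (n : ℕ) : a n ≤ |remCoeff n| * (1 / 133) ^ n +
      ∑ p ∈ Finset.HasAntidiagonal.antidiagonal n, a p.1 * b p.2 := by
    have hK : quotCoeff n = remCoeff n - ∑ p ∈ Finset.HasAntidiagonal.antidiagonal n,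
        quotCoeff p.1 * (if p.2 = 0 then 0 else nu (p.2 + 1)) := by
      rw [← sum_quotCoeff_mul, ← Finset.sum_sub_distrib,
        Finset.sum_eq_single_of_mem (n, 0) (by simp)]
      · simp [nu_one]
      · rintro ⟨i, j⟩ hij hne
        rw [Finset.HasAntidiagonal.mem_antidiagonal] at hij
        have : j ≠ 0 := by rintro rfl; exact hne (by simpa using hij)
        simp [this]
    have hab : ∑ p ∈ Finset.HasAntidiagonal.antidiagonal n, a p.1 * b p.2 = (∑ p ∈ Finset.HasAntidiagonal.antidiagonal n,
        |quotCoeff p.1 * (if p.2 = 0 then 0 else nu (p.2 + 1))|) * (1 / 133) ^ n := by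
      rw [Finset.sum_mul]
      refine Finset.sum_congr rfl fun p hp => ?_
      rw [Finset.HasAntidiagonal.mem_antidiagonal] at hp
      have : 0 ≤ (if p.2 = 0 then 0 else nu (p.2 + 1)) := by
        split_ifs
        · rfl
        · exact nu_nonneg _
      rw [ha, hb, abs_mul, abs_of_nonneg this, ← hp, pow_add]
      ring
    rw [hab, ← add_mul]
    simp only [ha]
    gcongr
    nth_rewrite 1 [hK]
    refine (abs_sub _ _).trans ?_
    gcongr
    exact Finset.abs_sum_le_sum_abs _ _
  have h2 := (Finset.sum_le_sum fun n (_ : n ∈ Finset.range N) => h1 n)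
  rw [Finset.sum_add_distrib] at h2
  have h3 := sum_range_sum_antidiagonal_le ha0 hb0 N
  have h4 : ∑ n ∈ Finset.range N, |remCoeff n| * (1 / 133) ^ n ≤ 1163400 :=
    (summable_remCoeff.sum_le_tsum _ fun n _ => by positivity).trans tsum_remCoeff_le
  have h5 : ∑ n ∈ Finset.range N, b n ≤ 54 / 100 := by
    refine le_trans ?_ tsum_nu_succ_le
    have hs : Summable fun n => nu (n + 2) * (1 / 133) ^ (n + 1) :=
      (summable_nat_add_iff 1).mpr summable_nu_succ
    rcases N with _ | N
    · rw [Finset.sum_range_zero]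
      exact tsum_nonneg fun n => mul_nonneg (nu_nonneg _) (by positivity)
    · rw [Finset.sum_range_succ']
      simp only [hb, Nat.add_eq_zero_iff, one_ne_zero, and_false, if_false, if_true, zero_mul,
        add_zero]
      exact hs.sum_le_tsum _ fun n _ => mul_nonneg (nu_nonneg _) (by positivity)
  have h6 : 0 ≤ ∑ n ∈ Finset.range N, a n := Finset.sum_nonneg fun n _ => ha0 n
  have h7 := mul_le_mul_of_nonneg_left h5 h6
  linarith

lemma summable_quotCoeff : Summable fun n => |quotCoeff n| * (1 / 133) ^ n :=
  summable_of_sum_range_le (fun n => by positivity) sum_quotCoeff_le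

lemma tsum_quotCoeff_le : ∑' n, |quotCoeff n| * (1 / 133) ^ n ≤ 2530000 :=
  Real.tsum_le_of_sum_range_le (fun n => by positivity) sum_quotCoeff_le

/-- The coefficients of the remainder series `∑ quotCoeff n qⁿ⁺²`. -/
def tailCoeff (n : ℕ) : ℝ := if n < 2 then 0 else quotCoeff (n - 2)

lemma tailCoeff_add_two (n : ℕ) : tailCoeff (n + 2) = quotCoeff n := by simp [tailCoeff]

/-- The holomorphic remainder in `E₆ / ∑ n σ₅(n) qⁿ = 1/q - 570 + 20256 q + tailSeries q`. -/
def tailSeries (q : ℂ) : ℂ := ∑' n, (tailCoeff n : ℂ) * q ^ n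

lemma summable_tailCoeff : Summable fun n => ‖(tailCoeff n : ℂ)‖ * (1 / 133) ^ n := by
  rw [← summable_nat_add_iff 2]
  refine (summable_quotCoeff.mul_left ((1 / 133) ^ 2)).congr fun n => ?_
  rw [tailCoeff_add_two, pow_add, norm_real, Real.norm_eq_abs]
  ring

lemma hasSum_quotCoeff {q : ℂ} (hq : ‖q‖ ≤ 1 / 133) :
    HasSum (fun n : ℕ => (quotCoeff n : ℂ) * q ^ (n + 2)) (tailSeries q) := by
  have h := (summable_norm_mul_pow summable_tailCoeff hq).of_norm.hasSum
  have h2 := (hasSum_nat_add_iff' 2).mpr h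
  simp only [tailCoeff_add_two] at h2
  convert! h2 using 1
  simp [Finset.sum_range_succ, tailCoeff, tailSeries]

lemma summable_norm_real_pow {a : ℕ → ℝ} {ρ : ℝ} (ha : Summable fun n => |a n| * ρ ^ n) {q : ℂ}
    (hq : ‖q‖ ≤ ρ) : Summable fun n => ‖(a n : ℂ) * q ^ n‖ :=
  summable_norm_mul_pow (a := fun n => (a n : ℂ)) (by simpa using ha) hq

lemma hasSum_nu_succ {q : ℂ} (hq : ‖q‖ ≤ 1 / 133) (hq0 : q ≠ 0) :
    HasSum (fun n => (nu (n + 1) : ℂ) * q ^ n) (nuSeries q / q) := by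
  have h := ((hasSum_nat_add_iff' 1).mpr (hasSum_nuSeries (by linarith : ‖q‖ < 1))).div_const q
  convert! h using 2 with n
  · field_simp; ring
  · simp [nu_zero]

lemma nuSeries_ne_zero {q : ℂ} (hq : ‖q‖ ≤ 1 / 133) (hq0 : q ≠ 0) : nuSeries q ≠ 0 := by
  intro h
  have h1 := hasSum_nu_succ hq hq0
  have h2 := (hasSum_nat_add_iff' 1).mpr h1
  rw [h] at h2
  simp only [Finset.sum_range_one, zero_add, nu_one, ofReal_one, pow_zero, mul_one, zero_div,
    zero_sub] at h2
  have hs : Summable fun n => nu (n + 2) * (1 / 133) ^ (n + 1) :=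
    (summable_nat_add_iff 1).mpr summable_nu_succ
  have h3 : ‖(-1 : ℂ)‖ ≤ 54 / 100 := by
    rw [← h2.tsum_eq]
    refine (tsum_of_norm_bounded hs.hasSum fun n => ?_).trans tsum_nu_succ_le
    rw [norm_mul, norm_pow, norm_real, Real.norm_of_nonneg (nu_nonneg _)]
    gcongr
    exact nu_nonneg _
  norm_num at h3

/-- The Laurent expansion of `E₆ / ∑ n σ₅(n) qⁿ` at the cusp. -/
lemma quotient_eq {q : ℂ} (hq : ‖q‖ ≤ 1 / 133) (hq0 : q ≠ 0) :
    (1 - 504 * sigSeries q) / nuSeries q = q⁻¹ - 570 + 20256 * q + tailSeries q := by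
  have hν := nuSeries_ne_zero hq hq0
  have hP := hasSum_nu_succ hq hq0
  have hq1 : ‖q‖ < 1 := by linarith
  have hS := hasSum_sigSeries hq1
  obtain ⟨s1, s2, s3, s4, s5⟩ := sig_values
  -- `remCoeff` collects the coefficients of degree at least `3` of the numerator; the lower ones
  -- cancel
  have hM : HasSum (fun n => (remCoeff n : ℂ) * q ^ n)
      ((1 - 504 * sigSeries q - (1 - 570 * q + 20256 * q ^ 2) * (nuSeries q / q)) / q ^ 3) := by
    have a1 := ((hasSum_nat_add_iff' 3).mpr hS).mul_left (-504)
    have a2 := (hasSum_nat_add_iff' 3).mpr hP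
    have a3 := ((hasSum_nat_add_iff' 2).mpr hP).mul_left (570 * q)
    have a4 := ((hasSum_nat_add_iff' 1).mpr hP).mul_left (20256 * q ^ 2)
    have := ((((a1.sub a2).add a3).sub a4).div_const (q ^ 3))
    convert! this using 1
    · ext n
      rw [remCoeff]
      push_cast
      field_simp
      ring
    · simp only [Finset.sum_range_succ, Finset.sum_range_zero, nu, sig_zero, s1, s2, s3]
      push_cast
      field_simp
      ring
  have hKs := summable_norm_real_pow summable_quotCoeff hq
  have hPs : Summable fun n => ‖(nu (n + 1) : ℂ) * q ^ n‖ :=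
    summable_norm_real_pow (a := fun n => nu (n + 1))
      (by simpa [abs_of_nonneg (nu_nonneg _)] using summable_nu_succ) hq
  have hprod : (∑' n, (quotCoeff n : ℂ) * q ^ n) * (nuSeries q / q) =
      (1 - 504 * sigSeries q - (1 - 570 * q + 20256 * q ^ 2) * (nuSeries q / q)) / q ^ 3 := by
    rw [← hP.tsum_eq, tsum_mul_tsum_eq_tsum_sum_antidiagonal_of_summable_norm hKs hPs, hP.tsum_eq,
      ← hM.tsum_eq]
    refine tsum_congr fun n => ?_
    rw [← sum_quotCoeff_mul]
    push_cast
    rw [Finset.sum_mul]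
    refine Finset.sum_congr rfl fun p hp => ?_
    rw [Finset.HasAntidiagonal.mem_antidiagonal] at hp
    rw [← hp, pow_add]
    ring
  have hT : tailSeries q = q ^ 2 * ∑' n, (quotCoeff n : ℂ) * q ^ n := by
    rw [← (hasSum_quotCoeff hq).tsum_eq, ← tsum_mul_left]
    exact tsum_congr fun n => by ring
  rw [hT]
  generalize (∑' n, (quotCoeff n : ℂ) * q ^ n) = k at *
  field_simp at hprod ⊢
  linear_combination -hprod

lemma abs_im_pow_le (q : ℂ) (n : ℕ) : |(q ^ (n + 1)).im| ≤ (n + 1) * ‖q‖ ^ n * |q.im| := by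
  induction n with
  | zero => simp
  | succ n ih =>
    rw [pow_succ, mul_im]
    calc |(q ^ (n + 1)).re * q.im + (q ^ (n + 1)).im * q.re|
        ≤ |(q ^ (n + 1)).re| * |q.im| + |(q ^ (n + 1)).im| * |q.re| := by
          rw [← abs_mul, ← abs_mul]; exact abs_add_le _ _
      _ ≤ ‖q‖ ^ (n + 1) * |q.im| + ((n + 1) * ‖q‖ ^ n * |q.im|) * ‖q‖ := by
          gcongr
          · rw [← norm_pow]; exact abs_re_le_norm _
          · exact abs_re_le_norm _
      _ = _ := by push_cast; ring

lemma norm_tailSeries_le {q : ℂ} (hq : ‖q‖ ≤ 1 / 133) : ‖tailSeries q‖ ≤ 2530000 * ‖q‖ ^ 2 := by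
  rw [← (hasSum_quotCoeff hq).tsum_eq]
  refine (tsum_of_norm_bounded (summable_quotCoeff.hasSum.mul_right (‖q‖ ^ 2))
    fun n => ?_).trans (mul_le_mul_of_nonneg_right tsum_quotCoeff_le (by positivity))
  rw [norm_mul, norm_pow, norm_real, Real.norm_eq_abs, pow_add, ← mul_assoc]
  gcongr

/-- Imaginary parts of power series with real coefficients are controlled by `Im q`. -/
lemma abs_im_hasSum_le {q s : ℂ} {c : ℕ → ℝ} {C : ℝ} (hq : ‖q‖ ≤ 1 / 230)
    (hc : ∀ n : ℕ, |c n| * (n + 2) * (1 / 230) ^ n ≤ C * (|quotCoeff n| * (1 / 133) ^ n))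
    (hC : 0 ≤ C) (hs : HasSum (fun n => (c n : ℂ) * q ^ (n + 2)) s) :
    |s.im| ≤ C * 2530000 * ‖q‖ * |q.im| := by
  have h1 : HasSum (fun n => ((c n : ℂ) * q ^ (n + 2)).im) s.im := hasSum_im hs
  rw [← h1.tsum_eq, ← Real.norm_eq_abs]
  refine (tsum_of_norm_bounded ((summable_quotCoeff.hasSum.mul_left C).mul_right
    (‖q‖ * |q.im|)) fun n => ?_).trans ?_
  · rw [Real.norm_eq_abs, im_ofReal_mul, abs_mul]
    calc |c n| * |(q ^ (n + 2)).im|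
        ≤ |c n| * (((n + 1 : ℕ) + 1) * ‖q‖ ^ (n + 1) * |q.im|) := by
          gcongr; exact abs_im_pow_le q (n + 1)
      _ = |c n| * (n + 2) * ‖q‖ ^ n * (‖q‖ * |q.im|) := by push_cast; ring
      _ ≤ |c n| * (n + 2) * (1 / 230) ^ n * (‖q‖ * |q.im|) := by gcongr
      _ ≤ _ := mul_le_mul_of_nonneg_right (hc n) (by positivity)
  · calc _ ≤ C * 2530000 * (‖q‖ * |q.im|) := by gcongr; exact tsum_quotCoeff_le
      _ = _ := by ring

lemma add_two_mul_pow_le (n : ℕ) : ((n : ℝ) + 2) * (1 / 230) ^ n ≤ 2 * (1 / 133) ^ n := by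
  induction n with
  | zero => norm_num
  | succ n ih =>
    have h0 : (0 : ℝ) < (1 / 230) ^ n := by positivity
    have hn : (0 : ℝ) ≤ n * (1 / 230) ^ n := by positivity
    push_cast
    rw [pow_succ, pow_succ]
    nlinarith

lemma add_two_sq_mul_pow_le (n : ℕ) :
    ((n : ℝ) + 2) ^ 2 * (1 / 230) ^ n ≤ 54 / 10 * (1 / 133) ^ n := by
  rcases lt_or_ge n 2 with h | h
  · interval_cases n <;> norm_num
  · induction n, h using Nat.le_induction with
    | base => norm_num
    | succ n hn ih =>
      have h2 : (2 : ℝ) ≤ n := by exact_mod_cast hn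
      have h3 : (((n + 1 : ℕ) : ℝ) + 2) ^ 2 ≤ 230 / 133 * ((n : ℝ) + 2) ^ 2 := by
        push_cast; nlinarith
      calc (((n + 1 : ℕ) : ℝ) + 2) ^ 2 * (1 / 230) ^ (n + 1)
          ≤ (230 / 133 * ((n : ℝ) + 2) ^ 2) * (1 / 230) ^ (n + 1) := by gcongr
        _ = 1 / 133 * (((n : ℝ) + 2) ^ 2 * (1 / 230) ^ n) := by rw [pow_succ]; ring
        _ ≤ 1 / 133 * (54 / 10 * (1 / 133) ^ n) := by gcongr
        _ = _ := by rw [pow_succ]; ring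

lemma abs_im_tailSeries_le {q : ℂ} (hq : ‖q‖ ≤ 1 / 230) :
    |(tailSeries q).im| ≤ 2 * 2530000 * ‖q‖ * |q.im| := by
  refine abs_im_hasSum_le hq (fun n => ?_) (by norm_num) (hasSum_quotCoeff (by linarith))
  have := mul_le_mul_of_nonneg_left (add_two_mul_pow_le n) (abs_nonneg (quotCoeff n))
  linarith

/-- The imaginary part of the Euler derivative `q T'(q)` of the tail series is controlled by
`Im q`. -/
lemma hasDerivAt_tailSeries {q : ℂ} (hq : ‖q‖ ≤ 1 / 230) :
    ∃ d, HasDerivAt tailSeries d q ∧ |(q * d).im| ≤ 54 / 10 * 2530000 * ‖q‖ * |q.im| := by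
  have hq' : ‖q‖ < 1 / 133 := by linarith
  refine ⟨_, (differentiableAt_tsum_mul_pow summable_tailCoeff hq').hasDerivAt, ?_⟩
  have h := (hasSum_deriv_tsum_mul_pow summable_tailCoeff hq').mul_left q
  have h2 := (hasSum_nat_add_iff' 2).mpr h
  simp only [tailCoeff_add_two] at h2
  refine abs_im_hasSum_le (c := fun n => (n + 2) * quotCoeff n) hq (fun n => ?_) (by norm_num) ?_
  · have := mul_le_mul_of_nonneg_left (add_two_sq_mul_pow_le n) (abs_nonneg (quotCoeff n))
    rw [abs_mul, abs_of_nonneg (by positivity : (0 : ℝ) ≤ n + 2)]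
    linarith
  · convert! h2 using 1
    · ext n
      push_cast
      ring
    · simp [Finset.sum_range_succ, tailCoeff]

/-! ### Estimates on the half strip `0 ≤ Re z ≤ 1/2`, `Im z ≥ √3/2` -/

/-- On `Im z ≥ √3/2` the size `exp(2π Im z)` of `1/q` is at least `230`, with a linear gain in
height. -/
lemma le_exp_two_pi_mul {y : ℝ} (hy : √3 / 2 ≤ y) :
    230 * (1 + 2 * Real.pi * (y - √3 / 2)) ≤ Real.exp (2 * Real.pi * y) := by
  have h3 : (1.732 : ℝ) ≤ √3 := Real.le_sqrt_of_sq_le (by norm_num)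
  have hpi := Real.pi_gt_d4
  have h5 : (5.44 : ℝ) ≤ Real.pi * √3 := by
    calc (5.44 : ℝ) ≤ 3.1415 * 1.732 := by norm_num
      _ ≤ _ := by gcongr
  have he : (230 : ℝ) ≤ Real.exp 5.44 := by
    have h1 : (2.71828 : ℝ) ≤ Real.exp 1 := by linarith [Real.exp_one_gt_d9]
    have h2 := Real.sum_le_exp_of_nonneg (show (0 : ℝ) ≤ 0.44 by norm_num) 5
    norm_num [Finset.sum_range_succ, Nat.factorial] at h2
    rw [show (5.44 : ℝ) = 1 + 1 + 1 + 1 + 1 + 0.44 by norm_num]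
    simp only [Real.exp_add]
    calc (230 : ℝ) ≤ 2.71828 * 2.71828 * 2.71828 * 2.71828 * 2.71828 * 1.5525 := by norm_num
      _ ≤ _ := by gcongr; linarith
  rw [show 2 * Real.pi * y = Real.pi * √3 + 2 * Real.pi * (y - √3 / 2) by ring, Real.exp_add]
  have h6 : 0 ≤ 2 * Real.pi * (y - √3 / 2) := mul_nonneg (by positivity) (by linarith)
  gcongr
  · exact he.trans (Real.exp_le_exp.mpr h5)
  · linarith [Real.add_one_le_exp (2 * Real.pi * (y - √3 / 2))]

lemma norm_nome_inv (z : ℂ) : ‖nome z‖⁻¹ = Real.exp (2 * Real.pi * z.im) := by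
  rw [norm_nome, Real.exp_neg, inv_inv]

lemma norm_nome_pos (z : ℂ) : 0 < ‖nome z‖ := norm_pos_iff.mpr (nome_ne_zero z)

lemma norm_nome_le {z : ℂ} (hz : √3 / 2 ≤ z.im) : ‖nome z‖ ≤ 1 / 230 := by
  have h := le_exp_two_pi_mul hz
  rw [← norm_nome_inv] at h
  have h6 : 0 ≤ 2 * Real.pi * (z.im - √3 / 2) :=
    mul_nonneg (by positivity) (by linarith)
  rw [one_div, le_inv_comm₀ (norm_nome_pos z) (by norm_num)]
  linarith

lemma nome_re (z : ℂ) : (nome z).re = ‖nome z‖ * Real.cos (2 * Real.pi * z.re) := by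
  rw [norm_nome, nome, Complex.exp_re]; simp

lemma nome_im (z : ℂ) : (nome z).im = ‖nome z‖ * Real.sin (2 * Real.pi * z.re) := by
  rw [norm_nome, nome, Complex.exp_im]; simp

lemma nome_im_pos {z : ℂ} (h0 : 0 < z.re) (h1 : z.re < 1 / 2) : 0 < (nome z).im := by
  rw [nome_im]
  refine mul_pos (norm_nome_pos z) (Real.sin_pos_of_pos_of_lt_pi (by positivity) ?_)
  nlinarith [Real.pi_pos]

lemma equivariant_eq {z : ℂ} (hz : ‖nome z‖ ≤ 1 / 133) :
    equivariant z = z + Complex.I / (168 * Real.pi) *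
      ((nome z)⁻¹ - 570 + 20256 * nome z + tailSeries (nome z)) := by
  rw [equivariant, quotient_eq hz (nome_ne_zero z)]

lemma equivariant_re {z : ℂ} (hz : ‖nome z‖ ≤ 1 / 133) :
    168 * Real.pi * (equivariant z).re = 168 * Real.pi * z.re +
      ((nome z).im / ‖nome z‖ ^ 2 - 20256 * (nome z).im - (tailSeries (nome z)).im) := by
  have hpi := Real.pi_ne_zero
  have h : (168 * Real.pi : ℝ) * equivariant z = (168 * Real.pi : ℝ) * z + Complex.I *
      ((nome z)⁻¹ - 570 + 20256 * nome z + tailSeries (nome z)) := by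
    rw [equivariant_eq hz]
    push_cast
    field_simp
  have h2 := congrArg Complex.re h
  rw [re_ofReal_mul, add_re, re_ofReal_mul, I_mul_re] at h2
  rw [h2, ← normSq_eq_norm_sq]
  simp
  ring

lemma equivariant_im {z : ℂ} (hz : ‖nome z‖ ≤ 1 / 133) :
    168 * Real.pi * (equivariant z).im = 168 * Real.pi * z.im +
      ((nome z).re / ‖nome z‖ ^ 2 - 570 + 20256 * (nome z).re + (tailSeries (nome z)).re) := by
  have hpi := Real.pi_ne_zero
  have h : (168 * Real.pi : ℝ) * equivariant z = (168 * Real.pi : ℝ) * z + Complex.I *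
      ((nome z)⁻¹ - 570 + 20256 * nome z + tailSeries (nome z)) := by
    rw [equivariant_eq hz]
    push_cast
    field_simp
  have h2 := congrArg Complex.im h
  rw [im_ofReal_mul, add_im, im_ofReal_mul, I_mul_im] at h2
  rw [h2, ← normSq_eq_norm_sq]
  simp

/-- On the left half strip `Re h > 0`: the term `1/q` contributes `Im q / |q|² ≥ 52900 Im q`, which
exceeds the contributions of `20256 q` and of the tail. -/
lemma equivariant_re_pos {z : ℂ} (hz : √3 / 2 ≤ z.im) (h0 : 0 < z.re) (h1 : z.re < 1 / 2) :
    0 < (equivariant z).re := by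
  have hr := norm_nome_le hz
  have hr0 := norm_nome_pos z
  have hi := nome_im_pos h0 h1
  have hT := (abs_le.mp (abs_im_tailSeries_le hr)).2
  rw [abs_of_pos hi] at hT
  have h := equivariant_re (by linarith : ‖nome z‖ ≤ 1 / 133)
  have hpi := Real.pi_pos
  have h2 : 52900 * (nome z).im ≤ (nome z).im / ‖nome z‖ ^ 2 := by
    rw [le_div_iff₀ (by positivity)]
    have : ‖nome z‖ ^ 2 ≤ (1 / 230) ^ 2 := by gcongr
    nlinarith
  have h3 : 2 * 2530000 * ‖nome z‖ * (nome z).im ≤ 2 * 2530000 * (1 / 230) * (nome z).im := by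
    gcongr
  have h4 : 0 < 168 * Real.pi * z.re := by positivity
  rw [← mul_pos_iff_of_pos_left (by positivity : 0 < 168 * Real.pi)]
  rw [h]
  linarith

lemma abs_re_tailSeries_le {z : ℂ} (hz : √3 / 2 ≤ z.im) : |(tailSeries (nome z)).re| ≤ 48 := by
  have hr := norm_nome_le hz
  refine (abs_re_le_norm _).trans ((norm_tailSeries_le (by linarith)).trans ?_)
  calc 2530000 * ‖nome z‖ ^ 2 ≤ 2530000 * (1 / 230) ^ 2 := by gcongr
    _ ≤ 48 := by norm_num

lemma nome_re_div (z : ℂ) :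
    (nome z).re / ‖nome z‖ ^ 2 = Real.exp (2 * Real.pi * z.im) * Real.cos (2 * Real.pi * z.re) := by
  have := (norm_nome_pos z).ne'
  rw [nome_re, ← norm_nome_inv]
  field_simp

lemma equivariant_im_pos_of_re_eq_zero {z : ℂ} (hz : √3 / 2 ≤ z.im) (h0 : z.re = 0) :
    0 < (equivariant z).im := by
  have hr := norm_nome_le hz
  have h := equivariant_im (by linarith : ‖nome z‖ ≤ 1 / 133)
  have hT := (abs_le.mp (abs_re_tailSeries_le hz)).1
  have he := le_exp_two_pi_mul hz
  rw [nome_re_div, h0, mul_zero, Real.cos_zero, mul_one, nome_re, h0, mul_zero, Real.cos_zero,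
    mul_one] at h
  have hpi := Real.pi_gt_three
  have h3 : (1.732 : ℝ) ≤ √3 := Real.le_sqrt_of_sq_le (by norm_num)
  have hr0 := norm_nome_pos z
  have h6 : 0 ≤ 2 * Real.pi * (z.im - √3 / 2) := mul_nonneg (by positivity) (by linarith)
  have h7 : 168 * 3 * 0.866 ≤ 168 * Real.pi * z.im := by gcongr; linarith
  rw [← mul_pos_iff_of_pos_left (by positivity : 0 < 168 * Real.pi)]
  rw [h]
  linarith

lemma equivariant_im_neg_of_re_eq_half {z : ℂ} (hz : √3 / 2 ≤ z.im) (h0 : z.re = 1 / 2) :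
    (equivariant z).im < 0 := by
  have hr := norm_nome_le hz
  have h := equivariant_im (by linarith : ‖nome z‖ ≤ 1 / 133)
  have hT := (abs_le.mp (abs_re_tailSeries_le hz)).2
  have he := le_exp_two_pi_mul hz
  rw [nome_re_div, nome_re, h0, show 2 * Real.pi * (1 / 2) = Real.pi by ring, Real.cos_pi] at h
  have hpi := Real.pi_gt_three
  have hpi' := Real.pi_lt_d2
  have h3 : √3 ≤ 1.7321 := Real.sqrt_le_iff.mpr ⟨by norm_num, by norm_num⟩
  have hr0 := norm_nome_pos z
  have h6 : 0 ≤ Real.pi * (z.im - √3 / 2) := mul_nonneg (by positivity) (by linarith)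
  have h7 : 168 * Real.pi * (√3 / 2) ≤ 168 * 3.15 * (1.7321 / 2) := by gcongr
  have h8 : 168 * Real.pi * (equivariant z).im < 0 := by
    rw [h]
    linarith
  exact neg_of_mul_neg_right h8 (by positivity)

lemma isOpen_norm_nome_lt : IsOpen {z : ℂ | ‖nome z‖ < 1 / 133} := by
  refine isOpen_lt ?_ continuous_const
  unfold nome
  fun_prop

/-- The derivative of the equivariant function has negative imaginary part on the left half strip.
In `h' = 1 - (-1/q + 20256 q + q T'(q)) / 84` the first two terms in the bracket have imaginary
parts of the same sign, and together they outweigh the tail. -/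
lemma hasDerivAt_equivariant {z : ℂ} (hz : √3 / 2 ≤ z.im) :
    ∃ d, HasDerivAt equivariant d z ∧ (0 < z.re → z.re < 1 / 2 → d.im < 0) := by
  have hr := norm_nome_le hz
  obtain ⟨t, ht, ht'⟩ := hasDerivAt_tailSeries hr
  have hq0 := nome_ne_zero z
  have hn := hasDerivAt_nome z
  have hpi : (Real.pi : ℂ) ≠ 0 := by exact_mod_cast Real.pi_ne_zero
  have h1 := (hasDerivAt_id z).add (((((hn.inv hq0).sub_const 570).add (hn.const_mul 20256)).add
    (ht.comp z hn)).const_mul (Complex.I / (168 * Real.pi)))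
  have h2 : equivariant =ᶠ[𝓝 z] fun z => z + Complex.I / (168 * Real.pi) *
      ((nome z)⁻¹ - 570 + 20256 * nome z + tailSeries (nome z)) := by
    have : ‖nome z‖ < 1 / 133 := by linarith
    filter_upwards [isOpen_norm_nome_lt.mem_nhds this] with w hw
    exact equivariant_eq (le_of_lt hw)
  have h3 : HasDerivAt equivariant
      (1 - 1 / 84 * (-(nome z)⁻¹ + 20256 * nome z + nome z * t)) z := by
    convert! h1.congr_of_eventuallyEq h2 using 1
    field_simp
    linear_combination 168 * (1 - 20256 * nome z ^ 2 - t * nome z ^ 2) * I_sq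
  refine ⟨_, h3, fun h0 h1 => ?_⟩
  have hi := nome_im_pos h0 h1
  have hr0 := norm_nome_pos z
  rw [abs_of_pos hi] at ht'
  have hT := (abs_le.mp ht').1
  have e1 : (1 - 1 / 84 * (-(nome z)⁻¹ + 20256 * nome z + nome z * t)).im =
      -(1 / 84) * ((nome z).im / ‖nome z‖ ^ 2 + 20256 * (nome z).im + (nome z * t).im) := by
    rw [← normSq_eq_norm_sq, show (1 / 84 : ℂ) = ((1 / 84 : ℝ) : ℂ) by push_cast; rfl, sub_im,
      im_ofReal_mul, add_im, add_im, neg_im, inv_im]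
    simp
    ring
  have h2 : 52900 * (nome z).im ≤ (nome z).im / ‖nome z‖ ^ 2 := by
    rw [le_div_iff₀ (by positivity)]
    have : ‖nome z‖ ^ 2 ≤ (1 / 230) ^ 2 := by gcongr
    nlinarith
  have h3 : 54 / 10 * 2530000 * ‖nome z‖ * (nome z).im ≤
      54 / 10 * 2530000 * (1 / 230) * (nome z).im := by
    gcongr
  rw [e1]
  linarith

lemma analyticAt_equivariant {z : ℂ} (hz : √3 / 2 ≤ z.im) : AnalyticAt ℂ equivariant z := by
  have hd : DifferentiableOn ℂ equivariant {z : ℂ | ‖nome z‖ < 1 / 133} := by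
    intro w hw
    have h1 : DifferentiableAt ℂ nome w := (hasDerivAt_nome w).differentiableAt
    have h2 : DifferentiableAt ℂ (fun z => z + Complex.I / (168 * Real.pi) *
      ((nome z)⁻¹ - 570 + 20256 * nome z + tailSeries (nome z))) w := by
      have h3 : DifferentiableAt ℂ (fun z => tailSeries (nome z)) w :=
        (differentiableAt_tsum_mul_pow summable_tailCoeff hw).comp w h1
      have h4 : DifferentiableAt ℂ (fun z => (nome z)⁻¹) w := h1.inv (nome_ne_zero w)
      fun_prop
    refine (h2.congr_of_eventuallyEq ?_).differentiableWithinAt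
    filter_upwards [isOpen_norm_nome_lt.mem_nhds hw] with u hu
    exact equivariant_eq (le_of_lt hu)
  have hr := norm_nome_le hz
  have : ‖nome z‖ < 1 / 133 := by linarith
  exact hd.analyticAt (isOpen_norm_nome_lt.mem_nhds this)

lemma nuSeries_nome_ne_zero {z : ℂ} (hz : √3 / 2 ≤ z.im) : nuSeries (nome z) ≠ 0 :=
  nuSeries_ne_zero ((norm_nome_le hz).trans (by norm_num)) (nome_ne_zero z)

lemma nome_neg_conj (z : ℂ) : nome (-conj z) = conj (nome z) := by
  rw [nome, nome, ← exp_conj]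
  simp [conj_ofNat]

lemma nome_add_one (z : ℂ) : nome (z + 1) = nome z := by
  rw [nome, nome, mul_add, mul_one, exp_add, exp_two_pi_mul_I, mul_one]

lemma tsum_real_mul_pow_conj (a : ℕ → ℝ) (q : ℂ) :
    ∑' n, (a n : ℂ) * conj q ^ n = conj (∑' n, (a n : ℂ) * q ^ n) := by
  rw [conj_tsum]
  exact tsum_congr fun n => by simp

lemma equivariant_neg_conj (z : ℂ) : equivariant (-conj z) = -conj (equivariant z) := by
  rw [equivariant, equivariant, nome_neg_conj, sigSeries, nuSeries, tsum_real_mul_pow_conj,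
    tsum_real_mul_pow_conj, ← sigSeries, ← nuSeries]
  simp [neg_div, conj_ofNat]
  ring

lemma equivariant_add_one (z : ℂ) : equivariant (z + 1) = equivariant z + 1 := by
  rw [equivariant, equivariant, nome_add_one]
  ring

/-- On the unit circle the equivariant function takes values in the unit circle. -/
lemma norm_equivariant_eq_one {τ : ℍ} (hy : √3 / 2 ≤ τ.im) (hτ : ‖(τ : ℂ)‖ = 1) :
    ‖equivariant τ‖ = 1 := by
  have hS : ((ModularGroup.S • τ : ℍ) : ℂ) = -conj (τ : ℂ) := by
    have h : (τ : ℂ) * conj (τ : ℂ) = 1 := by rw [mul_conj, normSq_eq_norm_sq, hτ]; simp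
    have hτ0 := τ.ne_zero
    rw [modular_S_smul]
    change (-(τ : ℂ))⁻¹ = _
    field_simp
    linear_combination h
  have h := equivariant_S τ (nuSeries_nome_ne_zero hy)
    (by rw [hS]; exact nuSeries_nome_ne_zero (by simpa using hy))
  rw [hS, equivariant_neg_conj] at h
  have h2 : ((‖equivariant τ‖ ^ 2 : ℝ) : ℂ) = 1 := by
    rw [← normSq_eq_norm_sq, ← mul_conj]
    linear_combination -h
  have h3 : ‖equivariant τ‖ ^ 2 = 1 := by exact_mod_cast h2
  nlinarith [norm_nonneg (equivariant τ)]

/-! ### The curve on which the equivariant function is real -/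

/-- The imaginary part of the equivariant function, as a function of `(y, x)` with `z = x + iy`. -/
def imEquivariant (p : ℝ × ℝ) : ℝ := (equivariant (p.2 + p.1 * Complex.I)).im

lemma imEquivariant_of (z : ℂ) : imEquivariant (z.im, z.re) = (equivariant z).im := by
  simp [imEquivariant]

lemma contDiffAt_imEquivariant {p : ℝ × ℝ} (hp : √3 / 2 ≤ p.1) :
    ContDiffAt ℝ ∞ imEquivariant p := by
  have h1 : ContDiffAt ℝ ∞ equivariant ((p.2 : ℂ) + p.1 * Complex.I) :=
    ((analyticAt_equivariant (by simpa using hp)).contDiffAt (n := ∞)).restrict_scalars ℝ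
  have h2 : ContDiffAt ℝ ∞ (fun p : ℝ × ℝ => (p.2 : ℂ) + p.1 * Complex.I) p := by
    have e1 : ContDiff ℝ ∞ (fun p : ℝ × ℝ => (p.2 : ℂ)) := ofRealCLM.contDiff.comp contDiff_snd
    have e2 : ContDiff ℝ ∞ (fun p : ℝ × ℝ => (p.1 : ℂ)) := ofRealCLM.contDiff.comp contDiff_fst
    exact (e1.add (e2.mul contDiff_const)).contDiffAt
  exact imCLM.contDiff.contDiffAt.comp p (h1.comp p h2)

lemma hasDerivAt_imEquivariant {x y : ℝ} (hy : √3 / 2 ≤ y) :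
    ∃ d : ℝ, HasDerivAt (fun x => imEquivariant (y, x)) d x ∧ (0 < x → x < 1 / 2 → d < 0) := by
  obtain ⟨d, hd, hd'⟩ := hasDerivAt_equivariant (z := x + y * Complex.I) (by simpa using hy)
  refine ⟨d.im, ?_, fun h0 h1 => hd' (by simpa using h0) (by simpa using h1)⟩
  have h1 : HasDerivAt (fun x : ℝ => (x : ℂ) + y * Complex.I) 1 x :=
    (ofRealCLM.hasDerivAt (x := x)).add_const _
  have h2 := hd.comp x h1
  rw [mul_one] at h2
  exact imCLM.hasFDerivAt.comp_hasDerivAt x h2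

lemma strictAntiOn_imEquivariant {y : ℝ} (hy : √3 / 2 ≤ y) :
    StrictAntiOn (fun x => imEquivariant (y, x)) (Icc 0 (1 / 2)) := by
  refine strictAntiOn_of_deriv_neg (convex_Icc _ _) (fun x _ => ?_) fun x hx => ?_
  · obtain ⟨d, hd, -⟩ := hasDerivAt_imEquivariant (x := x) hy
    exact hd.continuousAt.continuousWithinAt
  · rw [interior_Icc] at hx
    obtain ⟨d, hd, hd'⟩ := hasDerivAt_imEquivariant (x := x) hy
    rw [hd.deriv]
    exact hd' hx.1 hx.2

lemma imEquivariant_zero_pos {y : ℝ} (hy : √3 / 2 ≤ y) : 0 < imEquivariant (y, 0) :=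
  equivariant_im_pos_of_re_eq_zero (by simpa using hy) (by simp)

lemma imEquivariant_half_neg {y : ℝ} (hy : √3 / 2 ≤ y) : imEquivariant (y, 1 / 2) < 0 :=
  equivariant_im_neg_of_re_eq_half (by simpa using hy) (by simp)

lemma exists_imEquivariant_eq_zero {y : ℝ} (hy : √3 / 2 ≤ y) :
    ∃ x ∈ Ioo (0 : ℝ) (1 / 2), imEquivariant (y, x) = 0 := by
  have hc : ContinuousOn (fun x => imEquivariant (y, x)) (Icc 0 (1 / 2)) := fun x _ => by
    obtain ⟨d, hd, -⟩ := hasDerivAt_imEquivariant (x := x) hy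
    exact hd.continuousAt.continuousWithinAt
  exact intermediate_value_Ioo' (by norm_num) hc
    ⟨imEquivariant_half_neg hy, imEquivariant_zero_pos hy⟩

open Classical in
/-- The real part of the point at height `y` on the curve `Im h = 0` in the strip
`0 < Re z < 1/2`; the junk value `1/4` below the height `√3/2` of the cube root of unity. -/
def curveRe (y : ℝ) : ℝ :=
  if hy : √3 / 2 ≤ y then (exists_imEquivariant_eq_zero hy).choose else 1 / 4

lemma curveRe_mem {y : ℝ} (hy : √3 / 2 ≤ y) : curveRe y ∈ Ioo (0 : ℝ) (1 / 2) := by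
  rw [curveRe, dif_pos hy]
  exact (exists_imEquivariant_eq_zero hy).choose_spec.1

lemma imEquivariant_curveRe {y : ℝ} (hy : √3 / 2 ≤ y) : imEquivariant (y, curveRe y) = 0 := by
  rw [curveRe, dif_pos hy]
  exact (exists_imEquivariant_eq_zero hy).choose_spec.2

lemma eq_curveRe {x y : ℝ} (hy : √3 / 2 ≤ y) (h0 : 0 ≤ x) (h1 : x ≤ 1 / 2)
    (h : imEquivariant (y, x) = 0) : x = curveRe y :=
  (strictAntiOn_imEquivariant hy).injOn ⟨h0, h1⟩ (Ioo_subset_Icc_self (curveRe_mem hy))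
    (h.trans (imEquivariant_curveRe hy).symm)

lemma lt_curveRe_iff {x y : ℝ} (hy : √3 / 2 ≤ y) (h0 : 0 ≤ x) (h1 : x ≤ 1 / 2) :
    x < curveRe y ↔ 0 < imEquivariant (y, x) := by
  rw [← imEquivariant_curveRe hy]
  exact ((strictAntiOn_imEquivariant hy).lt_iff_gt (Ioo_subset_Icc_self (curveRe_mem hy))
    ⟨h0, h1⟩).symm

lemma curveRe_lt_iff {x y : ℝ} (hy : √3 / 2 ≤ y) (h0 : 0 ≤ x) (h1 : x ≤ 1 / 2) :
    curveRe y < x ↔ imEquivariant (y, x) < 0 := by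
  rw [← imEquivariant_curveRe hy]
  exact ((strictAntiOn_imEquivariant hy).lt_iff_gt ⟨h0, h1⟩
    (Ioo_subset_Icc_self (curveRe_mem hy))).symm

/-- By uniqueness of the zero on each horizontal segment, `curveRe` agrees locally with the implicit
function of `Im h = 0`, which is smooth because `∂ₓ Im h ≠ 0`. -/
lemma contDiffAt_curveRe {y : ℝ} (hy : √3 / 2 < y) : ContDiffAt ℝ ∞ curveRe y := by
  have hc : ContDiffAt ℝ ∞ imEquivariant (y, curveRe y) := contDiffAt_imEquivariant hy.le
  have hx := curveRe_mem hy.le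
  obtain ⟨d, hd, hd'⟩ := hasDerivAt_imEquivariant (x := curveRe y) hy.le
  have hd0 : d ≠ 0 := (hd' hx.1 hx.2).ne
  have hinr : fderiv ℝ imEquivariant (y, curveRe y) ∘L .inr ℝ ℝ ℝ =
      ContinuousLinearMap.toSpanSingleton ℝ d := by
    have h1 : HasFDerivAt (fun x : ℝ => (y, x)) (.inr ℝ ℝ ℝ) (curveRe y) :=
      hasFDerivAt_prodMk_right y (curveRe y)
    have h2 := (hc.differentiableAt (by simp)).hasFDerivAt.comp (curveRe y) h1
    exact h2.unique hd.hasFDerivAt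
  have hinv : (fderiv ℝ imEquivariant (y, curveRe y) ∘L .inr ℝ ℝ ℝ).IsInvertible := by
    rw [hinr]
    refine ⟨ContinuousLinearEquiv.unitsEquivAut ℝ (Units.mk0 d hd0), ?_⟩
    ext
    simp
  have h1 := hc.contDiffAt_implicitFunction (by simp) hinv
  refine h1.congr_of_eventuallyEq ?_
  have h2 := hc.eventually_apply_implicitFunction (by simp) hinv
  have h3 : ∀ᶠ t in 𝓝 y, hc.implicitFunction (by simp) hinv t ∈ Ioo (0 : ℝ) (1 / 2) := by
    refine h1.continuousAt.eventually_mem (isOpen_Ioo.mem_nhds ?_)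
    rw [hc.implicitFunction_apply_self]
    exact hx
  filter_upwards [h2, h3, lt_mem_nhds hy] with t a1 a2 a3
  rw [imEquivariant_curveRe hy.le] at a1
  exact (eq_curveRe a3.le a2.1.le a2.2.le a1).symm

/-- The point at height `y` on the curve `Im h = 0` in the strip `0 < Re z < 1/2`. -/
def curvePt (y : ℝ) : ℂ := curveRe y + y * Complex.I

@[simp] lemma curvePt_re (y : ℝ) : (curvePt y).re = curveRe y := by simp [curvePt]

@[simp] lemma curvePt_im (y : ℝ) : (curvePt y).im = y := by simp [curvePt]

lemma equivariant_curvePt_im {y : ℝ} (hy : √3 / 2 ≤ y) : (equivariant (curvePt y)).im = 0 := by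
  rw [← imEquivariant_of, curvePt_re, curvePt_im, imEquivariant_curveRe hy]

lemma equivariant_curvePt_re_pos {y : ℝ} (hy : √3 / 2 ≤ y) : 0 < (equivariant (curvePt y)).re :=
  equivariant_re_pos (by simpa using hy) (by simpa using (curveRe_mem hy).1)
    (by simpa using (curveRe_mem hy).2)

lemma hasDerivAt_curvePt {y : ℝ} (hy : √3 / 2 < y) :
    HasDerivAt curvePt ((deriv curveRe y : ℝ) + Complex.I) y := by
  have h1 := ((contDiffAt_curveRe hy).differentiableAt (by simp)).hasDerivAt
  have h2 : HasDerivAt (fun y => (curveRe y : ℂ)) (deriv curveRe y : ℝ) y := h1.ofReal_comp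
  have h3 : HasDerivAt (fun y : ℝ => (y : ℂ) * Complex.I) (1 * Complex.I) y :=
    (ofRealCLM.hasDerivAt (x := y)).mul_const _
  rw [one_mul] at h3
  exact h2.add h3

lemma contDiffAt_curvePt {y : ℝ} (hy : √3 / 2 < y) : ContDiffAt ℝ ∞ curvePt y := by
  have e1 : ContDiffAt ℝ ∞ (fun y => (curveRe y : ℂ)) y :=
    ofRealCLM.contDiff.contDiffAt.comp y (contDiffAt_curveRe hy)
  have e2 : ContDiff ℝ ∞ (fun y : ℝ => (y : ℂ)) := ofRealCLM.contDiff
  exact e1.add (e2.contDiffAt.mul contDiffAt_const)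

/-- The derivative of the (real) values of `h` along the curve does not vanish, as `h'` has
nonzero imaginary part there. -/
lemma hasDerivAt_equivariant_curvePt {y : ℝ} (hy : √3 / 2 < y) :
    ∃ d : ℝ, HasDerivAt (fun y => (equivariant (curvePt y)).re) d y ∧ d ≠ 0 := by
  have hx := curveRe_mem hy.le
  obtain ⟨d, hd, hd'⟩ := hasDerivAt_equivariant (z := curvePt y) (by simpa using hy.le)
  have hdim := hd' (by simpa using hx.1) (by simpa using hx.2)
  have h1 := hd.comp y (hasDerivAt_curvePt hy)
  have hre := reCLM.hasFDerivAt.comp_hasDerivAt y h1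
  have him := imCLM.hasFDerivAt.comp_hasDerivAt y h1
  have h0 : (d * ((deriv curveRe y : ℝ) + Complex.I)).im = 0 := by
    refine him.unique ((hasDerivAt_const y (0 : ℝ)).congr_of_eventuallyEq ?_)
    filter_upwards [lt_mem_nhds hy] with t ht
    exact equivariant_curvePt_im ht.le
  refine ⟨_, hre, fun h => ?_⟩
  have h2 : d * ((deriv curveRe y : ℝ) + Complex.I) = 0 := Complex.ext h h0
  rcases mul_eq_zero.mp h2 with h3 | h3
  · rw [h3] at hdim
    simp at hdim
  · have := congrArg Complex.im h3
    simp at this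

/-- By Rolle's theorem, the equivariant function is injective along the curve. -/
lemma injOn_equivariant_curvePt :
    InjOn (fun y => (equivariant (curvePt y)).re) (Ioi (√3 / 2)) := by
  have key : ∀ a b, √3 / 2 < a → a < b →
      (equivariant (curvePt a)).re ≠ (equivariant (curvePt b)).re := by
    intro a b ha hab h
    choose! d hd hd0 using fun y (hy : √3 / 2 < y) => hasDerivAt_equivariant_curvePt hy
    obtain ⟨c, hc, hc0⟩ := exists_hasDerivAt_eq_zero (f' := d) hab
      (fun t ht => (hd t (ha.trans_le ht.1)).continuousAt.continuousWithinAt) h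
      (fun t ht => hd t (ha.trans ht.1))
    exact hd0 c (ha.trans hc.1) hc0
  intro a ha b hb hab
  rcases lt_trichotomy a b with h | h | h
  · exact (key a b ha h hab).elim
  · exact h
  · exact (key b a hb h hab.symm).elim

lemma equivariant_curvePt_eq_one {y : ℝ} (hy : √3 / 2 < y) (h : curveRe y ^ 2 + y ^ 2 = 1) :
    equivariant (curvePt y) = 1 := by
  have hy0 : 0 < y := (by positivity : (0 : ℝ) ≤ √3 / 2).trans_lt hy
  have him := equivariant_curvePt_im hy.le
  have hre := equivariant_curvePt_re_pos hy.le
  have hn : ‖curvePt y‖ = 1 := by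
    rw [← sq_eq_sq₀ (norm_nonneg _) zero_le_one, ← normSq_eq_norm_sq, normSq_apply]
    simp only [curvePt_re, curvePt_im]
    linarith
  have h1 := norm_equivariant_eq_one (τ := ⟨curvePt y, by simpa using hy0⟩)
    (by simpa [UpperHalfPlane.im] using hy.le) hn
  have h2 : ((equivariant (curvePt y)).re) ^ 2 = 1 := by
    have := normSq_eq_norm_sq (equivariant (curvePt y))
    rw [normSq_apply, him] at this
    change ‖equivariant (curvePt y)‖ = 1 at h1
    rw [h1] at this
    linarith
  refine Complex.ext ?_ (by simpa using him)
  rw [one_re]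
  nlinarith

lemma continuousOn_curveRe : ContinuousOn curveRe (Ioi (√3 / 2)) := fun _ hy =>
  (contDiffAt_curveRe hy).continuousAt.continuousWithinAt

lemma sqrt_three_half_sq : (√3 / 2) ^ 2 = 3 / 4 := by
  rw [div_pow, Real.sq_sqrt (by norm_num)]; norm_num

/-- The curve starts inside the unit circle. -/
lemma exists_curvePt_inside : ∃ y, √3 / 2 < y ∧ y < 1 ∧ curveRe y ^ 2 + y ^ 2 < 1 := by
  have hq := sqrt_three_half_sq
  have hq0 : 0 ≤ √3 / 2 := by positivity
  have hlt1 : √3 / 2 < 1 := by nlinarith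
  -- near `exp(πi/3)` the unit circle lies in the region `Im h < 0`
  have hc : ContinuousAt (fun y : ℝ => imEquivariant (y, √(1 - y ^ 2))) (√3 / 2) := by
    have h1 : ContinuousAt imEquivariant (√3 / 2, √(1 - (√3 / 2) ^ 2)) :=
      (contDiffAt_imEquivariant le_rfl).continuousAt
    refine h1.comp (f := fun y : ℝ => (y, √(1 - y ^ 2))) ?_
    fun_prop
  have h0 : imEquivariant (√3 / 2, √(1 - (√3 / 2) ^ 2)) < 0 := by
    rw [hq, show (1 - 3 / 4 : ℝ) = (1 / 2) ^ 2 by norm_num, Real.sqrt_sq (by norm_num)]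
    exact imEquivariant_half_neg le_rfl
  have h2 := (hc.eventually_lt_const h0).filter_mono (nhdsWithin_le_nhds (s := Ioi (√3 / 2)))
  obtain ⟨y, ⟨hy1, hy2⟩, hy3⟩ := ((h2.and (Ioo_mem_nhdsGT hlt1))).exists.imp
    fun y hy => (⟨hy.2, hy.1⟩ : y ∈ Ioo (√3 / 2) 1 ∧ _)
  refine ⟨y, hy1, hy2, ?_⟩
  have hs : √(1 - y ^ 2) ≤ 1 / 2 := Real.sqrt_le_iff.mpr ⟨by norm_num, by nlinarith⟩
  have h3 := (curveRe_lt_iff hy1.le (Real.sqrt_nonneg _) hs).mpr hy3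
  have h4 : curveRe y ^ 2 < √(1 - y ^ 2) ^ 2 := by
    have := (curveRe_mem hy1.le).1
    gcongr
  rw [Real.sq_sqrt (by nlinarith)] at h4
  linarith

/-- The curve enters the exterior of the unit circle at exactly one height: at a crossing the
value of `h` is `1`, and `h` is injective along the curve. -/
lemma exists_startHeight : ∃ y₁, √3 / 2 < y₁ ∧ curveRe y₁ ^ 2 + y₁ ^ 2 = 1 ∧
    ∀ y, √3 / 2 < y → (1 ≤ curveRe y ^ 2 + y ^ 2 ↔ y₁ ≤ y) := by
  obtain ⟨b, hb0, hb1, hb⟩ := exists_curvePt_inside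
  have hcont : ContinuousOn (fun y => curveRe y ^ 2 + y ^ 2) (Ioi (√3 / 2)) :=
    (continuousOn_curveRe.pow 2).add (continuousOn_id.pow 2)
  have hbig : ∀ y, 1 ≤ y → 1 < curveRe y ^ 2 + y ^ 2 := by
    intro y hy
    have hq := sqrt_three_half_sq
    have hq0 : 0 ≤ √3 / 2 := by positivity
    have := (curveRe_mem (y := y) (by nlinarith)).1
    nlinarith [pow_pos this 2]
  have huniq : ∀ y z, √3 / 2 < y → √3 / 2 < z → curveRe y ^ 2 + y ^ 2 = 1 →
      curveRe z ^ 2 + z ^ 2 = 1 → y = z := by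
    intro y z hy hz h1 h2
    refine injOn_equivariant_curvePt hy hz ?_
    simp only [equivariant_curvePt_eq_one hy h1, equivariant_curvePt_eq_one hz h2]
  have hup : ∀ u v, √3 / 2 < u → u ≤ v → curveRe u ^ 2 + u ^ 2 ≤ 1 → 1 ≤ curveRe v ^ 2 + v ^ 2 →
      ∃ w ∈ Icc u v, curveRe w ^ 2 + w ^ 2 = 1 := fun u v hu huv h1 h2 =>
    intermediate_value_Icc huv (hcont.mono fun t ht => hu.trans_le ht.1) ⟨h1, h2⟩
  have hdown : ∀ u v, √3 / 2 < u → u ≤ v → 1 ≤ curveRe u ^ 2 + u ^ 2 → curveRe v ^ 2 + v ^ 2 ≤ 1 →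
      ∃ w ∈ Icc u v, curveRe w ^ 2 + w ^ 2 = 1 := fun u v hu huv h1 h2 =>
    intermediate_value_Icc' huv (hcont.mono fun t ht => hu.trans_le ht.1) ⟨h2, h1⟩
  obtain ⟨y₁, hy₁, h₁⟩ := hup b 1 hb0 hb1.le hb.le (hbig 1 le_rfl).le
  have hy₁0 := hb0.trans_le hy₁.1
  have hby : b < y₁ := lt_of_le_of_ne hy₁.1 (by rintro rfl; linarith)
  refine ⟨y₁, hy₁0, h₁, fun y hy => ⟨fun h => ?_, fun h => ?_⟩⟩
  · by_contra! hlt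
    rcases le_total b y with hby' | hby'
    · obtain ⟨w, hw, hw1⟩ := hup b y hb0 hby' hb.le h
      have := huniq w y₁ (hb0.trans_le hw.1) hy₁0 hw1 h₁
      linarith [hw.2]
    · obtain ⟨w, hw, hw1⟩ := hdown y b hy hby' h hb.le
      have := huniq w y₁ (hy.trans_le hw.1) hy₁0 hw1 h₁
      linarith [hw.2]
  · by_contra! hlt
    rcases le_total y 1 with h1 | h1
    · obtain ⟨w, hw, hw1⟩ := hup y 1 hy h1 hlt.le (hbig 1 le_rfl).le
      have := huniq w y₁ (hy.trans_le hw.1) hy₁0 hw1 h₁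
      have hwy : w = y := le_antisymm (by linarith) hw.1
      rw [hwy] at hw1
      linarith
    · linarith [hbig y h1]

lemma eventually_lt_mul_exp {k : ℝ} (hk : 0 < k) :
    ∀ᶠ y : ℝ in atTop, 168 * Real.pi * y + 1000 < k * Real.exp (2 * Real.pi * y) := by
  have hpi := Real.pi_pos
  filter_upwards [eventually_ge_atTop 1,
    eventually_gt_atTop ((168 * Real.pi + 1000) / (2 * Real.pi ^ 2 * k))] with y h1 h2
  rw [div_lt_iff₀ (by positivity)] at h2
  have h3 := Real.quadratic_le_exp_of_nonneg (show 0 ≤ 2 * Real.pi * y by positivity)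
  have h4 : 0 ≤ 2 * Real.pi * y := by positivity
  calc 168 * Real.pi * y + 1000 ≤ (168 * Real.pi + 1000) * y := by nlinarith
    _ < (y * (2 * Real.pi ^ 2 * k)) * y := by gcongr
    _ = k * ((2 * Real.pi * y) ^ 2 / 2) := by ring
    _ ≤ k * Real.exp (2 * Real.pi * y) := by gcongr; linarith

/-- At large height, `168π Im h` is `168π y + exp(2πy) cos(2πx)` up to a bounded error. -/
lemma abs_imEquivariant_sub_le {x y : ℝ} (hy : √3 / 2 ≤ y) :
    |168 * Real.pi * imEquivariant (y, x) - 168 * Real.pi * y -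
      Real.exp (2 * Real.pi * y) * Real.cos (2 * Real.pi * x)| ≤ 1000 := by
  have hz : √3 / 2 ≤ ((x : ℂ) + y * Complex.I).im := by simpa using hy
  have hr := norm_nome_le hz
  have h := equivariant_im (by linarith : ‖nome (x + y * Complex.I)‖ ≤ 1 / 133)
  have hT := abs_re_tailSeries_le hz
  have hq := (abs_re_le_norm (nome (x + y * Complex.I))).trans hr
  rw [nome_re_div] at h
  simp only [add_im, add_re, ofReal_im, ofReal_re, mul_im, mul_re, Complex.I_im, Complex.I_re,
    mul_one, mul_zero, zero_add, add_zero, sub_zero] at h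
  rw [imEquivariant, h]
  rw [abs_le] at *
  constructor <;> linarith [hT.1, hT.2, hq.1, hq.2]

lemma tendsto_curveRe : Tendsto curveRe atTop (𝓝 (1 / 4)) := by
  have hpi := Real.pi_pos
  have hlarge : ∀ᶠ y : ℝ in atTop, √3 / 2 ≤ y := eventually_ge_atTop _
  rw [tendsto_order]
  constructor
  · intro a ha
    -- left of `Re z = 1/4` the exponentially large term of `Im h` is positive
    set x := max a (1 / 8) with hx
    have hx0 : 1 / 8 ≤ x := le_max_right _ _
    have hx1 : x < 1 / 4 := max_lt ha (by norm_num)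
    have hk : 0 < Real.cos (2 * Real.pi * x) :=
      Real.cos_pos_of_mem_Ioo ⟨by nlinarith, by nlinarith⟩
    filter_upwards [hlarge, eventually_lt_mul_exp hk] with y h1 h2
    refine (le_max_left a (1 / 8)).trans_lt
      ((lt_curveRe_iff h1 (by linarith) (by linarith)).mpr ?_)
    have h3 := (abs_le.mp (abs_imEquivariant_sub_le (x := x) h1)).1
    have hy : 0 ≤ 168 * Real.pi * y := by
      have : 0 ≤ √3 / 2 := by positivity
      exact mul_nonneg (by positivity) (this.trans h1)
    rw [← mul_pos_iff_of_pos_left (by positivity : 0 < 168 * Real.pi)]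
    linarith
  · intro b hb
    -- right of it, that term is negative
    set x := min b (3 / 8) with hx
    have hx0 : x ≤ 3 / 8 := min_le_right _ _
    have hx1 : 1 / 4 < x := lt_min hb (by norm_num)
    have hk : 0 < -Real.cos (2 * Real.pi * x) := neg_pos.mpr
      (Real.cos_neg_of_pi_div_two_lt_of_lt (by nlinarith) (by nlinarith))
    filter_upwards [hlarge, eventually_lt_mul_exp hk] with y h1 h2
    refine ((curveRe_lt_iff h1 (by linarith) (by linarith)).mpr ?_).trans_le
      (min_le_left b (3 / 8))
    have h3 := (abs_le.mp (abs_imEquivariant_sub_le (x := x) h1)).2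
    have h4 : 168 * Real.pi * imEquivariant (y, x) < 0 := by linarith
    exact neg_of_mul_neg_right h4 (by positivity)

/-! ### The two curves in the fundamental domain, and the density of the critical points -/

lemma sq_norm_eq (z : ℂ) : ‖z‖ ^ 2 = z.re ^ 2 + z.im ^ 2 := by
  rw [← normSq_eq_norm_sq, normSq_apply]; ring

lemma one_le_norm_iff (z : ℂ) : 1 ≤ ‖z‖ ↔ 1 ≤ z.re ^ 2 + z.im ^ 2 := by
  rw [← sq_norm_eq, one_le_sq_iff₀ (norm_nonneg z)]

lemma mem_F_iff (τ : ℍ) : τ ∈ F ↔ 0 ≤ τ.re ∧ τ.re ≤ 1 ∧ 1 ≤ τ.re ^ 2 + τ.im ^ 2 ∧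
    1 ≤ (τ.re - 1) ^ 2 + τ.im ^ 2 := by
  rw [F, mem_ofPred_eq, one_le_norm_iff, one_le_norm_iff]
  simp

lemma im_ge_of_mem_F {τ : ℍ} (h : τ ∈ F) : √3 / 2 ≤ τ.im := by
  rw [mem_F_iff] at h
  obtain ⟨h0, h1, h2, h3⟩ := h
  have hq := sqrt_three_half_sq
  have hq0 : 0 ≤ √3 / 2 := by positivity
  have hi := τ.im_pos
  refine (sq_le_sq₀ hq0 hi.le).mp ?_
  rw [hq]
  rcases le_total τ.re (1 / 2) with h | h <;> nlinarith

lemma mem_interior_F₀ {τ : ℍ} (h0 : 0 < τ.re) (h1 : τ.re < 1) (hy : √3 / 2 ≤ τ.im) :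
    τ ∈ interior F₀ := by
  have hq := sqrt_three_half_sq
  have hq0 : 0 ≤ √3 / 2 := by positivity
  rw [mem_interior]
  refine ⟨{τ | 0 < τ.re ∧ τ.re < 1 ∧ 1 / 2 < τ.im}, ?_, ?_, h0, h1, by nlinarith⟩
  · rintro w ⟨a0, a1, a2⟩
    refine ⟨a0.le, a1.le, ?_⟩
    have := (le_abs_self _).trans (abs_im_le_norm ((w : ℂ) - 1 / 2))
    have e : ((w : ℂ) - 1 / 2).im = w.im := by simp
    linarith
  · exact (isOpen_lt continuous_const UpperHalfPlane.continuous_re).inter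
      ((isOpen_lt UpperHalfPlane.continuous_re continuous_const).inter
        (isOpen_lt continuous_const UpperHalfPlane.continuous_im))

lemma mem_CLeft_iff (τ : ℍ) :
    τ ∈ CLeft ↔ τ ∈ F ∧ τ.re < 1 / 2 ∧ (equivariant τ).im = 0 := by
  constructor
  · rintro ⟨⟨⟨-, h1⟩, C, -, hC⟩, hF⟩
    refine ⟨hF, h1, ?_⟩
    rw [(f_eq_zero_iff C (nuSeries_nome_ne_zero (im_ge_of_mem_F hF))).mp hC, ofReal_im]
  · rintro ⟨hF, h1, him⟩
    have hy := im_ge_of_mem_F hF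
    have h0 : 0 < τ.re := lt_of_le_of_ne hF.1 fun h =>
      (equivariant_im_pos_of_re_eq_zero hy h.symm).ne' him
    refine ⟨⟨⟨mem_interior_F₀ h0 (by linarith) hy, h1⟩, (equivariant τ).re,
      equivariant_re_pos hy h0 h1, ?_⟩, hF⟩
    rw [f_eq_zero_iff _ (nuSeries_nome_ne_zero hy)]
    exact Complex.ext (by simp) (by simpa using him)

/-- The reflection `τ ↦ 1 - τ̄` of the upper half plane in the line `Re τ = 1/2`. -/
def reflect (τ : ℍ) : ℍ := ⟨1 - conj (τ : ℂ), by simpa using τ.im_pos⟩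

lemma coe_reflect (τ : ℍ) : (reflect τ : ℂ) = 1 - conj (τ : ℂ) := rfl

@[simp] lemma reflect_re (τ : ℍ) : (reflect τ).re = 1 - τ.re := by
  change (1 - conj (τ : ℂ)).re = _; simp

@[simp] lemma reflect_im (τ : ℍ) : (reflect τ).im = τ.im := by
  change (1 - conj (τ : ℂ)).im = _; simp

@[simp] lemma reflect_reflect (τ : ℍ) : reflect (reflect τ) = τ := by
  ext; simp [coe_reflect]

lemma continuous_reflect : Continuous reflect := by
  rw [UpperHalfPlane.isEmbedding_coe.continuous_iff]
  exact continuous_const.sub (continuous_conj.comp continuous_coe)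

lemma reflect_mem_F {τ : ℍ} : reflect τ ∈ F ↔ τ ∈ F := by
  rw [mem_F_iff, mem_F_iff, reflect_re, reflect_im, show (1 - τ.re) ^ 2 = (τ.re - 1) ^ 2 by ring,
    show (1 - τ.re - 1) ^ 2 = τ.re ^ 2 by ring]
  constructor <;> rintro ⟨h0, h1, h2, h3⟩ <;> exact ⟨by linarith, by linarith, h3, h2⟩

lemma equivariant_reflect (τ : ℍ) : equivariant (reflect τ) = 1 - conj (equivariant τ) := by
  rw [coe_reflect, show 1 - conj (τ : ℂ) = -conj (τ : ℂ) + 1 by ring, equivariant_add_one,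
    equivariant_neg_conj]
  ring

lemma mem_CRight_iff (τ : ℍ) :
    τ ∈ CRight ↔ τ ∈ F ∧ 1 / 2 < τ.re ∧ (equivariant τ).im = 0 := by
  constructor
  · rintro ⟨⟨⟨-, h1⟩, C, -, hC⟩, hF⟩
    refine ⟨hF, h1, ?_⟩
    rw [(f_eq_zero_iff C (nuSeries_nome_ne_zero (im_ge_of_mem_F hF))).mp hC, ofReal_im]
  · rintro ⟨hF, h1, him⟩
    have hy := im_ge_of_mem_F hF
    have hl : reflect τ ∈ CLeft := by
      rw [mem_CLeft_iff, reflect_mem_F, reflect_re, equivariant_reflect]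
      exact ⟨hF, by linarith, by simp [him]⟩
    have h2 : τ.re < 1 := lt_of_le_of_ne hF.2.1 fun h =>
      (equivariant_im_pos_of_re_eq_zero (z := reflect τ) (by simpa using hy) (by simp [h])).ne'
        (by simp [equivariant_reflect, him])
    have h3 := equivariant_re_pos (z := reflect τ) (by simpa using hy) (by simpa using h2)
      (by simp; linarith)
    rw [equivariant_reflect] at h3
    refine ⟨⟨⟨mem_interior_F₀ (by linarith) h2 hy, h1⟩, (equivariant τ).re,
      by simpa using h3, ?_⟩, hF⟩
    rw [f_eq_zero_iff _ (nuSeries_nome_ne_zero hy)]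
    exact Complex.ext (by simp) (by simpa using him)

lemma CRight_eq : CRight = reflect '' CLeft := by
  ext τ
  rw [mem_CRight_iff]
  constructor
  · rintro ⟨hF, h1, him⟩
    refine ⟨reflect τ, ?_, reflect_reflect τ⟩
    rw [mem_CLeft_iff, reflect_mem_F, reflect_re, equivariant_reflect]
    exact ⟨hF, by linarith, by simp [him]⟩
  · rintro ⟨σ, hσ, rfl⟩
    rw [mem_CLeft_iff] at hσ
    rw [reflect_mem_F, reflect_re, equivariant_reflect]
    exact ⟨hσ.1, by linarith [hσ.2.1], by simp [hσ.2.2]⟩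

lemma mem_union_iff (τ : ℍ) : τ ∈ CLeft ∪ CRight ↔ τ ∈ F ∧ (equivariant τ).im = 0 := by
  rw [mem_union, mem_CLeft_iff, mem_CRight_iff]
  constructor
  · rintro (⟨h1, -, h2⟩ | ⟨h1, -, h2⟩) <;> exact ⟨h1, h2⟩
  · rintro ⟨h1, h2⟩
    rcases lt_trichotomy τ.re (1 / 2) with h | h | h
    · exact Or.inl ⟨h1, h, h2⟩
    · exact ((equivariant_im_neg_of_re_eq_half (im_ge_of_mem_F h1) h).ne h2).elim
    · exact Or.inr ⟨h1, h, h2⟩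

lemma mem_D_iff (τ : ℍ) : τ ∈ D ↔ τ ∈ F ∧ ∃ r : ℚ, equivariant τ = r := by
  rw [D, mem_ofPred_eq]
  refine and_congr_right fun h => ?_
  exact exists_criticalPoint_iff (nuSeries_nome_ne_zero (im_ge_of_mem_F h))

lemma D_subset : D ⊆ CLeft ∪ CRight := by
  intro τ hτ
  obtain ⟨hF, r, hr⟩ := (mem_D_iff τ).mp hτ
  refine (mem_union_iff τ).mpr ⟨hF, ?_⟩
  rw [hr]
  exact_mod_cast ofReal_im r

lemma reflect_mem_D {τ : ℍ} (h : τ ∈ D) : reflect τ ∈ D := by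
  obtain ⟨hF, r, hr⟩ := (mem_D_iff τ).mp h
  refine (mem_D_iff _).mpr ⟨reflect_mem_F.mpr hF, 1 - r, ?_⟩
  rw [equivariant_reflect, hr]
  simp

/-- The points of the curve as elements of the upper half plane. -/
def curvePoint (y : ℝ) : ℍ := ofComplex (curvePt y)

lemma coe_curvePoint {y : ℝ} (hy : 0 < y) : (curvePoint y : ℂ) = curvePt y := by
  rw [curvePoint, ofComplex_apply_of_im_pos (by simpa using hy)]

lemma sqrt_three_half_pos : 0 < √3 / 2 := by positivity

lemma continuousAt_curvePoint {y : ℝ} (hy : √3 / 2 < y) : ContinuousAt curvePoint y := by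
  rw [UpperHalfPlane.isEmbedding_coe.continuousAt_iff]
  refine (contDiffAt_curvePt hy).continuousAt.congr ?_
  filter_upwards [lt_mem_nhds hy] with t ht
  exact (coe_curvePoint (sqrt_three_half_pos.trans ht)).symm

lemma curvePoint_mem_CLeft_iff {y : ℝ} (hy : √3 / 2 < y) :
    curvePoint y ∈ CLeft ↔ 1 ≤ curveRe y ^ 2 + y ^ 2 := by
  have hc := coe_curvePoint (sqrt_three_half_pos.trans hy)
  have hre : (curvePoint y).re = curveRe y := by
    rw [← coe_re, hc, curvePt_re]
  have him : (curvePoint y).im = y := by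
    rw [← coe_im, hc, curvePt_im]
  obtain ⟨h0, h1⟩ := curveRe_mem hy.le
  rw [mem_CLeft_iff, mem_F_iff, hre, him, hc, equivariant_curvePt_im hy.le]
  constructor
  · rintro ⟨⟨-, -, h, -⟩, -⟩
    exact h
  · intro h
    exact ⟨⟨h0.le, by linarith, h, by nlinarith⟩, h1, rfl⟩

lemma eq_curvePoint_of_mem_CLeft {τ : ℍ} (h : τ ∈ CLeft) :
    √3 / 2 < τ.im ∧ τ = curvePoint τ.im := by
  rw [mem_CLeft_iff] at h
  obtain ⟨hF, h1, him⟩ := h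
  have hy := im_ge_of_mem_F hF
  have hlt : √3 / 2 < τ.im := by
    refine lt_of_le_of_ne hy fun h => ?_
    have hq := sqrt_three_half_sq
    have := (mem_F_iff τ).mp hF
    rw [← h, hq] at this
    nlinarith
  refine ⟨hlt, ?_⟩
  have hre : τ.re = curveRe τ.im := eq_curveRe hy hF.1 h1.le (by
    have := imEquivariant_of τ
    rw [him] at this
    exact this)
  ext
  rw [coe_curvePoint τ.im_pos]
  exact Complex.ext (by simpa using hre) (by simp)

lemma CLeft_subset_closure_D : CLeft ⊆ closure D := by
  intro τ hτ
  obtain ⟨hy, hτy⟩ := eq_curvePoint_of_mem_CLeft hτ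
  obtain ⟨y₁, -, -, h₁⟩ := exists_startHeight
  have hy₁ : y₁ ≤ τ.im := by
    rw [hτy, curvePoint_mem_CLeft_iff hy, h₁ _ hy] at hτ
    exact hτ
  generalize τ.im = y at *
  subst hτy
  rw [mem_closure_iff_nhds]
  intro U hU
  obtain ⟨δ, hδ, hball⟩ := Metric.mem_nhds_iff.mp (continuousAt_curvePoint hy hU)
  -- `h` takes an interval of real values on a short arc, among them a rational one
  set b := y + δ / 2 with hb
  have hyb : y < b := by linarith
  set H : ℝ → ℝ := fun y => (equivariant (curvePt y)).re with hH
  have hne : H y ≠ H b := fun h => hyb.ne (injOn_equivariant_curvePt hy (hy.trans hyb) h)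
  have hcont : ContinuousOn H (uIcc y b) := fun t ht => by
    rw [uIcc_of_le hyb.le] at ht
    obtain ⟨d, hd, -⟩ := hasDerivAt_equivariant_curvePt (hy.trans_le ht.1)
    exact hd.continuousAt.continuousWithinAt
  obtain ⟨r, hr1, hr2⟩ := exists_rat_btwn (min_lt_max.mpr hne)
  obtain ⟨t, ht, htr⟩ := intermediate_value_uIcc hcont (show (r : ℝ) ∈ uIcc (H y) (H b) from
    ⟨hr1.le, hr2.le⟩)
  rw [uIcc_of_le hyb.le] at ht
  have hty := hy.trans_le ht.1
  refine ⟨curvePoint t, hball ?_, (mem_D_iff _).mpr ⟨?_, r, ?_⟩⟩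
  · rw [Metric.mem_ball, Real.dist_eq, abs_of_nonneg (by linarith [ht.1])]
    linarith [ht.2]
  · have : curvePoint t ∈ CLeft := by
      rw [curvePoint_mem_CLeft_iff hty, h₁ _ hty]
      exact hy₁.trans ht.1
    exact this.2
  · rw [coe_curvePoint (sqrt_three_half_pos.trans hty)]
    refine Complex.ext ?_ ?_
    · rw [ratCast_re]; exact htr
    · rw [ratCast_im]; exact equivariant_curvePt_im hty.le

lemma union_subset_closure_D : CLeft ∪ CRight ⊆ closure D := by
  refine union_subset CLeft_subset_closure_D ?_
  rw [CRight_eq]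
  rintro _ ⟨τ, hτ, rfl⟩
  exact map_mem_closure continuous_reflect (CLeft_subset_closure_D hτ) fun σ hσ => reflect_mem_D hσ

lemma isClosed_coe_image_union : IsClosed (((↑) : ℍ → ℂ) '' (CLeft ∪ CRight)) := by
  have hcl : IsClosed {z : ℂ | √3 / 2 ≤ z.im} := isClosed_le continuous_const Complex.continuous_im
  have hcont : ContinuousOn (fun z => (equivariant z).im) {z : ℂ | √3 / 2 ≤ z.im} := fun z hz =>
    (Complex.continuous_im.continuousAt.comp
      (analyticAt_equivariant hz).continuousAt).continuousWithinAt
  have h1 := hcont.preimage_isClosed_of_isClosed hcl (isClosed_singleton (x := 0))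
  have h2 : IsClosed {z : ℂ | 0 ≤ z.re ∧ z.re ≤ 1 ∧ 1 ≤ ‖z‖ ∧ 1 ≤ ‖z - 1‖} :=
    (isClosed_le continuous_const Complex.continuous_re).inter
      ((isClosed_le Complex.continuous_re continuous_const).inter
        ((isClosed_le continuous_const continuous_norm).inter
          (isClosed_le continuous_const (continuous_id.sub continuous_const).norm)))
  convert! h1.inter h2 using 1
  ext z
  constructor
  · rintro ⟨τ, hτ, rfl⟩
    rw [mem_union_iff] at hτ
    exact ⟨⟨im_ge_of_mem_F hτ.1, hτ.2⟩, hτ.1⟩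
  · rintro ⟨⟨hz, him⟩, hF⟩
    exact ⟨⟨z, sqrt_three_half_pos.trans_le hz⟩, (mem_union_iff _).mpr ⟨hF, him⟩, rfl⟩

/-- The locus `CLeft ∪ CRight` is the closure of `D` in the complex plane. -/
lemma closure_coe_image_D : closure (((↑) : ℍ → ℂ) '' D) = ((↑) : ℍ → ℂ) '' (CLeft ∪ CRight) := by
  refine Subset.antisymm (closure_minimal (image_mono D_subset) isClosed_coe_image_union) ?_
  exact (image_mono union_subset_closure_D).trans (image_closure_subset_closure_image continuous_coe)

lemma toSphere_image (S : Set ℍ) :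
    toSphere '' S = ((↑) : ℂ → OnePoint ℂ) '' (((↑) : ℍ → ℂ) '' S) := by
  rw [image_image]; rfl

lemma closure_toSphere_image_D_diff :
    closure (toSphere '' D) \ {OnePoint.infty} = toSphere '' (CLeft ∪ CRight) := by
  have h := (OnePoint.isOpenEmbedding_coe (X := ℂ)).isInducing.closure_eq_preimage_closure_image
    (((↑) : ℍ → ℂ) '' D)
  rw [toSphere_image, toSphere_image, ← closure_coe_image_D, h, image_preimage_eq_inter_range,
    ← OnePoint.compl_infty, Set.sdiff_eq]

lemma mem_frontier_F {τ : ℍ} (hF : τ ∈ F)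
    (h : τ.re ^ 2 + τ.im ^ 2 = 1 ∨ (τ.re - 1) ^ 2 + τ.im ^ 2 = 1) : τ ∈ frontier F := by
  refine ⟨subset_closure hF, fun hint => ?_⟩
  rw [mem_interior_iff_mem_nhds] at hint
  -- moving down from `τ` leaves the region
  have hc : ContinuousAt (fun s : ℝ => ofComplex ((τ : ℂ) - s * Complex.I)) 0 := by
    rw [UpperHalfPlane.isEmbedding_coe.continuousAt_iff]
    have : ContinuousAt (fun s : ℝ => (τ : ℂ) - s * Complex.I) 0 := by fun_prop
    refine this.congr ?_
    filter_upwards [gt_mem_nhds τ.im_pos] with s hs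
    rw [Function.comp_apply, ofComplex_apply_of_im_pos (by simpa using hs)]
  have h0 : ofComplex ((τ : ℂ) - (0 : ℝ) * Complex.I) = τ := by simp
  have h1 : ∀ᶠ s : ℝ in 𝓝 0, ofComplex ((τ : ℂ) - s * Complex.I) ∈ F := by
    refine hc.eventually_mem ?_
    rwa [h0]
  have h2 := (h1.and (gt_mem_nhds τ.im_pos)).filter_mono (nhdsWithin_le_nhds (s := Ioi 0))
  obtain ⟨s, ⟨hs1, hs2⟩, hs3⟩ := (h2.and self_mem_nhdsWithin).exists
  rw [mem_F_iff, ofComplex_apply_of_im_pos (by simpa using hs2)] at hs1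
  obtain ⟨-, -, e1, e2⟩ := hs1
  have hs3' : 0 < s := hs3
  simp only [UpperHalfPlane.re, UpperHalfPlane.im, sub_re, sub_im, re_ofReal_mul, im_ofReal_mul,
    Complex.I_re, Complex.I_im, mul_zero, mul_one, sub_zero] at e1 e2 h hs2
  have : ((τ : ℂ).im - s) ^ 2 < (τ : ℂ).im ^ 2 := by nlinarith
  rcases h with h | h <;> linarith

lemma IsSmoothCurveToCusp.reflect {S : Set ℍ} {p : ℍ} {x : ℝ} (h : IsSmoothCurveToCusp S p x) :
    IsSmoothCurveToCusp (E6Crit.reflect '' S) (E6Crit.reflect p) (1 - x) := by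
  obtain ⟨c, h1, h2, h3, h4, h5, h6, h7⟩ := h
  have hconj : ContDiff ℝ ∞ (fun z : ℂ => conj z) := conjCLE.contDiff
  refine ⟨fun t => 1 - conj (c t), contDiffOn_const.sub (hconj.comp_contDiffOn h1), ?_, ?_, ?_, ?_,
    ?_, ?_⟩
  · intro t ht
    have hd := ((h1.differentiableOn (by simp)) t ht).hasDerivWithinAt
    have hd2 : HasDerivWithinAt (fun t => 1 - conj (c t)) (-conj (derivWithin c (Ici 0) t))
        (Ici 0) t := by
      have := (conjCLE : ℂ ≃L[ℝ] ℂ).hasFDerivAt.comp_hasDerivWithinAt t hd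
      exact HasDerivWithinAt.const_sub 1 this
    rw [hd2.derivWithin (uniqueDiffOn_Ici 0 t ht)]
    simpa using h2 t ht
  · intro s hs t ht hst
    refine h3 hs ht ?_
    have : conj (c s) = conj (c t) := by simpa using hst
    exact (starRingEnd ℂ).injective this
  · have e1 : (fun t => 1 - conj (c t)) '' Ici 0 = (fun z : ℂ => 1 - conj z) '' (c '' Ici 0) := by
      rw [image_image]
    rw [e1, h4, image_image, image_image]
    rfl
  · simp only [h5]; rfl
  · simpa using h6.const_sub 1
  · simpa using h7

lemma isSmoothCurveToCusp_CLeft {y₁ : ℝ} (hy₁ : √3 / 2 < y₁)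
    (h₁ : ∀ y, √3 / 2 < y → (1 ≤ curveRe y ^ 2 + y ^ 2 ↔ y₁ ≤ y)) :
    IsSmoothCurveToCusp CLeft (curvePoint y₁) (1 / 4) := by
  have hpos (t : ℝ) (ht : t ∈ Ici (0 : ℝ)) : √3 / 2 < y₁ + t := by
    have : 0 ≤ t := ht
    linarith
  refine ⟨fun t => curvePt (y₁ + t), ?_, ?_, ?_, ?_, ?_, ?_, ?_⟩
  · intro t ht
    have h2 : ContDiffAt ℝ ∞ (fun t : ℝ => y₁ + t) t := contDiffAt_const.add contDiffAt_id
    exact ((contDiffAt_curvePt (hpos t ht)).comp t h2).contDiffWithinAt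
  · intro t ht
    have h2 := (hasDerivAt_curvePt (hpos t ht)).comp_const_add y₁ t
    rw [h2.hasDerivWithinAt.derivWithin (uniqueDiffOn_Ici 0 t ht)]
    intro h
    have := congrArg Complex.im h
    simp at this
  · intro s _ t _ hst
    have := congrArg Complex.im hst
    simpa using this
  · ext z
    constructor
    · rintro ⟨t, ht, rfl⟩
      refine ⟨curvePoint (y₁ + t), ?_, coe_curvePoint (sqrt_three_half_pos.trans (hpos t ht))⟩
      rw [curvePoint_mem_CLeft_iff (hpos t ht), h₁ _ (hpos t ht)]
      have : 0 ≤ t := ht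
      linarith
    · rintro ⟨τ, hτ, rfl⟩
      obtain ⟨hy, hτy⟩ := eq_curvePoint_of_mem_CLeft hτ
      have hle : y₁ ≤ τ.im := by
        rw [hτy, curvePoint_mem_CLeft_iff hy, h₁ _ hy] at hτ
        exact hτ
      refine ⟨τ.im - y₁, by simpa using hle, ?_⟩
      simp only [add_sub_cancel]
      rw [← coe_curvePoint τ.im_pos, ← hτy]
  · simp only [add_zero]
    exact (coe_curvePoint (sqrt_three_half_pos.trans hy₁)).symm
  · simpa using! tendsto_curveRe.comp (tendsto_atTop_add_const_left atTop y₁ tendsto_id)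
  · simpa using! tendsto_atTop_add_const_left atTop y₁ tendsto_id

end E6Crit

end

theorem theorem1p4 :
    (∃ τ₁ ∈ frontier E6Crit.F, ∃ τ₀ ∈ frontier E6Crit.F,
      E6Crit.f 1 τ₁ = 0 ∧ E6Crit.f 0 τ₀ = 0 ∧
      E6Crit.IsSmoothCurveToCusp E6Crit.CLeft τ₁ (1 / 4) ∧
      E6Crit.IsSmoothCurveToCusp E6Crit.CRight τ₀ (3 / 4)) ∧
    Disjoint E6Crit.CLeft E6Crit.CRight ∧
    E6Crit.D ⊆ E6Crit.CLeft ∪ E6Crit.CRight ∧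
    E6Crit.toSphere '' (E6Crit.CLeft ∪ E6Crit.CRight) =
      closure (E6Crit.toSphere '' E6Crit.D) ∩ E6Crit.toSphere '' E6Crit.F ∧
    E6Crit.toSphere '' (E6Crit.CLeft ∪ E6Crit.CRight) =
      closure (E6Crit.toSphere '' E6Crit.D) \ {OnePoint.infty} := by
  open E6Crit in
  refine ⟨?_, ?_, D_subset, ?_, closure_toSphere_image_D_diff.symm⟩
  · obtain ⟨y₁, hy₁, h1, h₁⟩ := exists_startHeight
    have hc := coe_curvePoint (sqrt_three_half_pos.trans hy₁)
    have hL : curvePoint y₁ ∈ CLeft :=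
      (curvePoint_mem_CLeft_iff hy₁).mpr ((h₁ y₁ hy₁).mpr le_rfl)
    have hnorm : (curvePoint y₁).re ^ 2 + (curvePoint y₁).im ^ 2 = 1 := by
      rw [← coe_re, ← coe_im, hc, curvePt_re, curvePt_im, h1]
    have hν : √3 / 2 ≤ (curvePoint y₁).im := im_ge_of_mem_F hL.2
    have hval : equivariant (curvePoint y₁) = 1 := by
      rw [hc, equivariant_curvePt_eq_one hy₁ h1]
    have hcurve := isSmoothCurveToCusp_CLeft hy₁ h₁
    refine ⟨curvePoint y₁, mem_frontier_F hL.2 (Or.inl hnorm), reflect (curvePoint y₁),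
      mem_frontier_F (reflect_mem_F.mpr hL.2) (Or.inr ?_), ?_, ?_, hcurve, ?_⟩
    · rw [reflect_re, reflect_im, ← hnorm]
      ring
    · rw [f_eq_zero_iff 1 (nuSeries_nome_ne_zero hν), hval, Complex.ofReal_one]
    · rw [f_eq_zero_iff 0 (nuSeries_nome_ne_zero (by simpa using hν)), equivariant_reflect, hval]
      simp
    · rw [CRight_eq, show (3 / 4 : ℝ) = 1 - 1 / 4 by norm_num]
      exact hcurve.reflect
  · rw [Set.disjoint_left]
    intro τ hl hr
    have h1 := ((mem_CLeft_iff τ).mp hl).2.1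
    have h2 := ((mem_CRight_iff τ).mp hr).2.1
    linarith
  · have hsub : toSphere '' (CLeft ∪ CRight) ⊆ toSphere '' F :=
      Set.image_mono fun τ hτ => ((mem_union_iff τ).mp hτ).1
    rw [← closure_toSphere_image_D_diff] at hsub ⊢
    refine Set.Subset.antisymm (fun z hz => ⟨hz.1, hsub hz⟩) ?_
    rintro _ ⟨hz, τ, -, rfl⟩
    exact ⟨hz, OnePoint.coe_ne_infty _⟩
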